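/- Let $x=(x_1,x_2,\ldots)$ be infinitely many indeterminates, let $p_k=\sum_{i\ge1}x_i^k$ for $k\ge1$, and put $p_\nu=p_{\nu_1}p_{\nu_2}\cdots$ for a partition $\nu$ (with $p_\emptyset=1$); the degree of the term $p_\nu$ is defined to be the length $\ell(\nu)$, i.e. the number of its parts. Define $q_k$ by $$\prod_{i\ge1}\frac{1+x_it}{1-x_it}=\sum_{k\ge0}q_k t^k ,$$ put $Q_{(a,b)}=q_aq_b+2\sum_{m=1}^{b}(-1)^mq_{a+m}q_{b-m}$, and for a strict partition $\lambda=(\lambda_1>\cdots>\lambda_\ell>0)$ define Schur's $Q$-function $Q_\lambda$ by $Q_\emptyset=1$ and the recurrences $$Q_{(\lambda_1,\ldots,\lambda_{2k+1})}=\sum_{m=1}^{2k+1}(-1)^{m+1}q_{\lambda_m}Q_{(\lambda_1,\ldots,\widehat{\lambda_m},\ldots,\lambda_{2k+1})},$$ $$Q_{(\lambda_1,\ldots,\lambda_{2k})}=\sum_{m=2}^{2k}(-1)^{m}Q_{(\lambda_1,\lambda_m)}Q_{(\lambda_2,\ldots,\widehat{\lambda_m},\ldots,\lambda_{2k})}\qquad(k\ge1).$$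 The shifted diagram of $\lambda$ is obtained from its Young diagram by moving the $i$-th row $i-1$ squares to the right. A bar tableau of shape $\lambda$ is a filling of the shifted diagram with positive integers such that (1) every row is weakly increasing; (2) every integer that occurs occurs an odd number of times; (3) every integer occurs in at most two rows, and if it occurs in two rows, then both of these rows begin with it; (4) for every $k$, after removing all squares with entries larger than $k$, the nonzero row lengths that remain are distinct. The squares with a given entry form one bar, so the number of bars is the number of distinct entries. Let $\mathrm{srank}(\lambda)$ be the smallest number of bars of a bar tableau of shape $\lambda$ (such tableaux exist). Theorem. For every strict partition $\lambda$, the function $Q_\lambda$ has a unique expansion $Q_\lambda=\sum_\nu c_\nu p_\nu$ as a finite linear combination with rational coefficients of the power sums $p_\nu$, and $$\min\{\ell(\nu): c_\nu\neq0\}=\mathrm{srank}(\lambda).$$ -/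

import Mathlib

noncomputable section

/-! ### Symmetric functions in infinitely many variables

Symmetric functions are formal power series over `ℚ` in the variables `x₀, x₁, x₂, …`.
Infinite sums and products are those of coefficientwise convergence. -/

section SymmetricFunctions

open scoped MvPowerSeries.WithPiTopology PowerSeries.WithPiTopology

/-- The power sum `p_k = ∑ᵢ xᵢ ^ k`, `k ≥ 1`. -/
def powerSum (k : ℕ+) : MvPowerSeries ℕ ℚ :=
  ∑' i : ℕ, (MvPowerSeries.X i : MvPowerSeries ℕ ℚ) ^ (k : ℕ)

/-- The factor `(1 + xᵢ t) / (1 - xᵢ t)`, a power series in `t`. -/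
def qFactor (i : ℕ) : PowerSeries (MvPowerSeries ℕ ℚ) :=
  (1 + PowerSeries.C (MvPowerSeries.X i) * PowerSeries.X) *
    PowerSeries.invOfUnit (1 - PowerSeries.C (MvPowerSeries.X i) * PowerSeries.X) 1

/-- The generating function `∏ᵢ (1 + xᵢ t) / (1 - xᵢ t)`, a power series in `t`. -/
def qSeries : PowerSeries (MvPowerSeries ℕ ℚ) := ∏' i : ℕ, qFactor i

/-- `q_k`, the coefficient of `t ^ k` in `∏ᵢ (1 + xᵢ t) / (1 - xᵢ t)`. -/
def qFun (k : ℕ) : MvPowerSeries ℕ ℚ := PowerSeries.coeff k qSeries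

theorem coeff_X_pow_eq (i : ℕ) (k : ℕ+) (d : ℕ →₀ ℕ) :
    MvPowerSeries.coeff d ((MvPowerSeries.X i : MvPowerSeries ℕ ℚ) ^ (k : ℕ)) =
      if d = Finsupp.single i (k : ℕ) then 1 else 0 := by
  classical
  rw [MvPowerSeries.coeff_X_pow]

theorem summable_powerSum (k : ℕ+) :
    Summable fun i : ℕ => (MvPowerSeries.X i : MvPowerSeries ℕ ℚ) ^ (k : ℕ) := by
  rw [MvPowerSeries.WithPiTopology.summable_iff_summable_coeff]
  intro d
  refine summable_of_ne_finset_zero (s := d.support) ?_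
  intro i hi
  rw [coeff_X_pow_eq, if_neg]
  rintro rfl
  exact hi (by simp)

theorem qFactor_eq (i : ℕ) :
    qFactor i = PowerSeries.mk fun n =>
      (if n = 0 then 1 else 2) * (MvPowerSeries.X i : MvPowerSeries ℕ ℚ) ^ n := by
  have hinv : PowerSeries.invOfUnit
      (1 - PowerSeries.C (MvPowerSeries.X i : MvPowerSeries ℕ ℚ) * PowerSeries.X) 1 =
      PowerSeries.mk fun n => (MvPowerSeries.X i : MvPowerSeries ℕ ℚ) ^ n := by
    have h1 := PowerSeries.mul_invOfUnit
      (1 - PowerSeries.C (MvPowerSeries.X i : MvPowerSeries ℕ ℚ) * PowerSeries.X) 1 (by simp)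
    have h2 : (PowerSeries.mk fun n => (MvPowerSeries.X i : MvPowerSeries ℕ ℚ) ^ n) *
        (1 - PowerSeries.C (MvPowerSeries.X i : MvPowerSeries ℕ ℚ) * PowerSeries.X) = 1 := by
      ext1 n
      rw [mul_sub, mul_one, mul_left_comm]
      cases n with
      | zero => simp
      | succ n =>
        rw [map_sub, PowerSeries.coeff_C_mul, PowerSeries.coeff_succ_mul_X]
        simp [pow_succ', PowerSeries.coeff_one]
    exact (left_inv_eq_right_inv h2 h1).symm
  rw [qFactor, hinv]
  ext1 n
  rw [add_mul, one_mul, mul_assoc, mul_comm PowerSeries.X]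
  cases n with
  | zero => simp
  | succ n =>
    rw [map_add, PowerSeries.coeff_C_mul, PowerSeries.coeff_succ_mul_X]
    simp only [PowerSeries.coeff_mk, Nat.succ_ne_zero, if_false]
    ring

theorem coeff_prod_qFactor (s : Finset ℕ) (k : ℕ) (d : ℕ →₀ ℕ) :
    MvPowerSeries.coeff d (PowerSeries.coeff k (∏ i ∈ s, qFactor i)) =
      if d.support ⊆ s ∧ d.degree = k then (2 : ℚ) ^ d.support.card else 0 := by
  classical
  induction s using Finset.induction_on generalizing k d with
  | empty =>
    rw [Finset.prod_empty, PowerSeries.coeff_one]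
    by_cases hk : k = 0
    · subst hk
      rw [if_pos rfl, MvPowerSeries.coeff_one]
      by_cases hd : d = 0
      · simp [hd]
      · simp [hd]
    · rw [if_neg hk, map_zero, if_neg]
      rintro ⟨h1, h2⟩
      have : d = 0 := by simpa using h1
      subst this
      exact hk (by simpa using h2.symm)
  | insert i s hi ih =>
    have hterm : ∀ a b : ℕ, MvPowerSeries.coeff d
        (PowerSeries.coeff a (qFactor i) * PowerSeries.coeff b (∏ i ∈ s, qFactor i)) =
        if a = d i then (if a = 0 then 1 else 2) *
          (if (d.erase i).support ⊆ s ∧ (d.erase i).degree = b then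
            (2 : ℚ) ^ (d.erase i).support.card else 0) else 0 := by
      intro a b
      have hc : ((if a = 0 then 1 else 2 : MvPowerSeries ℕ ℚ)) *
          (MvPowerSeries.X i : MvPowerSeries ℕ ℚ) ^ a =
          MvPowerSeries.monomial (Finsupp.single i a) (if a = 0 then 1 else 2 : ℚ) := by
        rw [MvPowerSeries.X_pow_eq]
        split_ifs
        · rw [one_mul]
        · rw [two_mul, ← map_add]; norm_num
      rw [qFactor_eq, PowerSeries.coeff_mk, hc, MvPowerSeries.coeff_monomial_mul, ih]
      by_cases ha : a = d i
      · have hle : Finsupp.single i a ≤ d := by simp [ha]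
        have he : d - Finsupp.single i a = d.erase i := by
          ext j
          by_cases hj : j = i
          · subst hj; simp [ha]
          · simp [Finsupp.erase_ne hj, Ne.symm hj]
        rw [if_pos hle, if_pos ha, he]
      · rw [if_neg ha]
        by_cases hle : Finsupp.single i a ≤ d
        · rw [if_pos hle]
          refine mul_eq_zero_of_right _ (if_neg ?_)
          rintro ⟨h1, -⟩
          refine hi (h1 ?_)
          have hlt : a ≤ d i := by simpa using hle
          simp only [Finsupp.mem_support_iff, Finsupp.coe_tsub, Pi.sub_apply,
            Finsupp.single_eq_same]
          omega
        · rw [if_neg hle]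
    have hdeg : d.degree = d i + (d.erase i).degree := by
      conv_lhs => rw [← Finsupp.single_add_erase i d]
      rw [map_add, Finsupp.degree_single]
    rw [Finset.prod_insert hi, PowerSeries.coeff_mul, map_sum]
    simp only [hterm]
    have hsub : (d.erase i).support ⊆ s ↔ d.support ⊆ insert i s := by
      rw [Finsupp.support_erase, Finset.subset_insert_iff]
    by_cases hk : d i ≤ k
    · rw [Finset.sum_eq_single (d i, k - d i)]
      · have hiff : (d.erase i).degree = k - d i ↔ d.degree = k := by omega
        simp only [if_true, hsub, hiff]
        by_cases hcond : d.support ⊆ insert i s ∧ d.degree = k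
        · rw [if_pos hcond, if_pos hcond, Finsupp.support_erase]
          by_cases h0 : d i = 0
          · rw [if_pos h0, one_mul, Finset.erase_eq_of_notMem (by simpa using h0)]
          · rw [if_neg h0, ← pow_succ', Finset.card_erase_add_one (by simpa using h0)]
        · rw [if_neg hcond, if_neg hcond, mul_zero]
      · rintro ⟨a, b⟩ hab hne
        rw [if_neg]
        rintro rfl
        apply hne
        rw [Finset.HasAntidiagonal.mem_antidiagonal] at hab
        dsimp only at hab
        rw [← hab, Nat.add_sub_cancel_left]
      · intro h
        exact absurd (by simp [hk]) h
    · rw [Finset.sum_eq_zero, if_neg]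
      · rintro ⟨-, h⟩
        omega
      · rintro ⟨a, b⟩ hab
        rw [if_neg]
        rintro rfl
        rw [Finset.HasAntidiagonal.mem_antidiagonal] at hab
        dsimp only at hab
        omega

theorem exists_coeff_eq (g : (ℕ →₀ ℕ) → ℚ) :
    ∃ f : MvPowerSeries ℕ ℚ, ∀ d, MvPowerSeries.coeff d f = g d := ⟨g, fun _ => rfl⟩

/-- The infinite product converges, and its coefficients are the expected ones. -/
theorem exists_hasProd_qFactor : ∃ f : ℕ → MvPowerSeries ℕ ℚ,
    (∀ k d, MvPowerSeries.coeff d (f k) =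
      if d.degree = k then (2 : ℚ) ^ d.support.card else 0) ∧
    HasProd qFactor (PowerSeries.mk f) := by
  choose f hf using fun k : ℕ => exists_coeff_eq fun d =>
    if d.degree = k then (2 : ℚ) ^ d.support.card else 0
  refine ⟨f, hf, ?_⟩
  rw [HasProd, PowerSeries.WithPiTopology.tendsto_iff_coeff_tendsto]
  intro k
  rw [MvPowerSeries.WithPiTopology.tendsto_iff_coeff_tendsto]
  intro d
  refine tendsto_const_nhds.congr' ?_
  rw [SummationFilter.unconditional_filter]
  filter_upwards [Filter.eventually_ge_atTop d.support] with s hs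
  rw [coeff_prod_qFactor, PowerSeries.coeff_mk, hf]
  have : d.support ⊆ s := hs
  simp only [this, true_and]

theorem hasProd_qFactor : HasProd qFactor qSeries := by
  obtain ⟨f, -, h⟩ := exists_hasProd_qFactor
  rw [qSeries, h.tprod_eq]
  exact h

theorem coeff_qFun (k : ℕ) (d : ℕ →₀ ℕ) :
    MvPowerSeries.coeff d (qFun k) = if d.degree = k then (2 : ℚ) ^ d.support.card else 0 := by
  obtain ⟨f, hf, h⟩ := exists_hasProd_qFactor
  rw [qFun, qSeries, h.tprod_eq, PowerSeries.coeff_mk, hf]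

end SymmetricFunctions

/-! ### Schur's `Q`-functions -/

/-- `Q_{(a,b)} = q_a q_b + 2 ∑_{m=1}^{b} (-1)^m q_{a+m} q_{b-m}`. -/
def schurQTwo (a b : ℕ) : MvPowerSeries ℕ ℚ :=
  qFun a * qFun b + 2 * ∑ m ∈ Finset.Icc 1 b, (-1) ^ m * (qFun (a + m) * qFun (b - m))

/-- Schur's `Q`-function `Q_lam`, by the recurrences in the length of `lam` (with `Q_∅ = 1`).
List positions are counted from `0`. -/
def schurQ : List ℕ → MvPowerSeries ℕ ℚ
  | [] => 1
  | a :: t =>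
    if Odd (a :: t).length then
      ∑ m : Fin (a :: t).length,
        (-1) ^ (m : ℕ) * (qFun ((a :: t).get m) * schurQ ((a :: t).eraseIdx m))
    else
      ∑ m : Fin t.length,
        (-1) ^ (m : ℕ) * (schurQTwo a (t.get m) * schurQ (t.eraseIdx m))
termination_by l => l.length
decreasing_by
  · have := m.isLt
    rw [List.length_eraseIdx_of_lt m.isLt]
    simp
  · have := m.isLt
    rw [List.length_eraseIdx_of_lt m.isLt]
    simp only [List.length_cons]
    omega

/-! ### The power sum expansion

A polynomial `F` in indeterminates indexed by `k = 1, 2, 3, …` stands for a finite linear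
combination of the `p_ν`: the exponent vector `m` of a monomial is the partition
`ν = ⟨1^{m₁} 2^{m₂} ⋯⟩`, the monomial stands for `p_ν = ∏ₖ p_k ^ {m_k}`, and its degree
`∑ₖ m_k` is the length of `ν`. -/

/-- `F` is a power sum expansion of `f`: putting `p_k` for the `k`-th indeterminate of `F`
yields `f`. -/
def IsPowerSumExpansion (F : MvPolynomial ℕ+ ℚ) (f : MvPowerSeries ℕ ℚ) : Prop :=
  MvPolynomial.aeval powerSum F = f

/-! ### Bar tableaux and the shifted rank -/

/-- The shifted diagram of `lam`: row `i` (from `0`) has the squares `(i, i), …,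
(i, i + lam i - 1)`. -/
def shiftedDiagram (lam : List ℕ) : Finset (ℕ × ℕ) :=
  Finset.univ.biUnion fun i : Fin lam.length =>
    {(i : ℕ)} ×ˢ Finset.Ico (i : ℕ) ((i : ℕ) + lam.get i)

/-- A bar tableau of shape `lam`: a filling of the shifted diagram with positive integers
(and, by convention, with `0` outside of it). -/
structure BarTableau (lam : List ℕ) where
  /-- The entry in a square. -/
  entry : ℕ × ℕ → ℕ
  entry_pos : ∀ c ∈ shiftedDiagram lam, 0 < entry c
  entry_eq_zero : ∀ c ∉ shiftedDiagram lam, entry c = 0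
  /-- The rows are weakly increasing. -/
  row_weak : ∀ i j₁ j₂, j₁ ≤ j₂ → (i, j₁) ∈ shiftedDiagram lam → (i, j₂) ∈ shiftedDiagram lam →
    entry (i, j₁) ≤ entry (i, j₂)
  /-- Every integer that occurs in the tableau occurs an odd number of times. -/
  odd_count : ∀ c ∈ shiftedDiagram lam,
    Odd ((shiftedDiagram lam).filter fun c' => entry c' = entry c).card
  /-- Every positive integer occurs in at most two rows. -/
  rows_le_two : ∀ k, 0 < k →
    (((shiftedDiagram lam).filter fun c => entry c = k).image Prod.fst).card ≤ 2
  /-- If a positive integer occurs in two rows, then both of these rows begin with it. -/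
  begin_of_two_rows : ∀ k, 0 < k → ∀ c ∈ shiftedDiagram lam, ∀ c' ∈ shiftedDiagram lam,
    entry c = k → entry c' = k → c.1 ≠ c'.1 → entry (c.1, c.1) = k ∧ entry (c'.1, c'.1) = k
  /-- Removing all squares with entries larger than `k` leaves rows whose nonzero lengths are
  distinct. -/
  distinct_rows : ∀ k i i', i ≠ i' →
    ((shiftedDiagram lam).filter fun c => c.1 = i ∧ entry c ≤ k).card ≠ 0 →
    ((shiftedDiagram lam).filter fun c => c.1 = i ∧ entry c ≤ k).card ≠
      ((shiftedDiagram lam).filter fun c => c.1 = i' ∧ entry c ≤ k).card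

/-- The number of bars of a bar tableau. The squares with a given entry form one bar, so this
is the number of distinct entries. -/
def BarTableau.numBars {lam : List ℕ} (T : BarTableau lam) : ℕ :=
  ((shiftedDiagram lam).image T.entry).card

/-- The shifted rank of `lam`: the number of bars in a minimal bar tableau of shape `lam`. -/
def srank (lam : List ℕ) : ℕ :=
  sInf {b | ∃ T : BarTableau lam, T.numBars = b}

theorem mem_shiftedDiagram (lam : List ℕ) (i j : ℕ) :
    (i, j) ∈ shiftedDiagram lam ↔ ∃ h : i < lam.length, i ≤ j ∧ j < i + lam[i] := by
  simp only [shiftedDiagram, Finset.mem_biUnion, Finset.mem_univ, true_and, Finset.mem_product,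
    Finset.mem_singleton, Finset.mem_Ico]
  constructor
  · rintro ⟨⟨i', hi'⟩, rfl, h⟩
    exact ⟨hi', h⟩
  · rintro ⟨h, h'⟩
    exact ⟨⟨i, h⟩, rfl, h'⟩

/-- A strict partition has a bar tableau, so that `srank` is a minimum. -/
theorem exists_barTableau (lam : List ℕ) (hstrict : lam.Pairwise (· > ·)) :
    Nonempty (BarTableau lam) := by
  classical
  -- Rows are filled one after the other with increasing distinct numbers.
  let D := shiftedDiagram lam
  let M := D.sup Prod.snd + 1
  have hM : ∀ c ∈ D, c.2 < M := fun c hc => Nat.lt_succ_of_le (Finset.le_sup (f := Prod.snd) hc)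
  let e : ℕ × ℕ → ℕ := fun c => if c ∈ D then c.1 * M + c.2 + 1 else 0
  have he : ∀ c ∈ D, e c = c.1 * M + c.2 + 1 := fun c hc => if_pos hc
  have hlt : ∀ c ∈ D, ∀ c' ∈ D, c.1 < c'.1 → e c < e c' := by
    intro c hc c' hc' h
    rw [he c hc, he c' hc']
    have h1 := hM c hc
    have h2 : (c.1 + 1) * M ≤ c'.1 * M := Nat.mul_le_mul_right M h
    rw [Nat.add_mul] at h2
    omega
  have hinj : ∀ c ∈ D, ∀ c' ∈ D, e c = e c' → c = c' := by
    intro c hc c' hc' h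
    rcases lt_trichotomy c.1 c'.1 with h1 | h1 | h1
    · have := hlt c hc c' hc' h1
      omega
    · rw [he c hc, he c' hc', h1] at h
      exact Prod.ext h1 (by omega)
    · have := hlt c' hc' c hc h1
      omega
  have hrow : ∀ i, (D.filter fun c => c.1 = i).card = lam.getD i 0 := by
    intro i
    have : (D.filter fun c => c.1 = i) = (Finset.Ico i (i + lam.getD i 0)).image (Prod.mk i) := by
      ext ⟨i', j⟩
      simp only [Finset.mem_filter, D, mem_shiftedDiagram, Finset.mem_image, Finset.mem_Ico,
        Prod.mk.injEq]
      constructor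
      · rintro ⟨⟨h, h1, h2⟩, rfl⟩
        exact ⟨j, by simpa [h] using ⟨h1, h2⟩, rfl, rfl⟩
      · rintro ⟨j', ⟨h1, h2⟩, rfl, rfl⟩
        by_cases h : i < lam.length
        · refine ⟨⟨h, h1, ?_⟩, rfl⟩
          simpa [h] using h2
        · simp [h] at h2
          omega
    rw [this, Finset.card_image_of_injective _ (Prod.mk_right_injective i)]
    simp
  have hdec : ∀ i i', i < i' → lam.getD i' 0 ≠ 0 → lam.getD i' 0 < lam.getD i 0 := by
    intro i i' h h0
    have h' : i' < lam.length := by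
      by_contra hc
      exact h0 (by simp [Nat.le_of_not_lt hc])
    have := List.pairwise_iff_getElem.1 hstrict i i' (h.trans h') h' h
    simpa [h', h.trans h'] using this
  have hkey : ∀ k i i', i < i' →
      (D.filter fun c => c.1 = i' ∧ e c ≤ k).card ≠ 0 →
      (D.filter fun c => c.1 = i' ∧ e c ≤ k).card < (D.filter fun c => c.1 = i ∧ e c ≤ k).card := by
    intro k i i' h h0
    have h1 : (D.filter fun c => c.1 = i' ∧ e c ≤ k).card ≤ lam.getD i' 0 := by
      rw [← hrow]
      exact Finset.card_le_card fun c hc => by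
        simp only [Finset.mem_filter] at hc ⊢
        exact ⟨hc.1, hc.2.1⟩
    have h2 : (D.filter fun c => c.1 = i ∧ e c ≤ k) = D.filter fun c => c.1 = i := by
      obtain ⟨c', hc'⟩ := Finset.card_ne_zero.1 h0
      simp only [Finset.mem_filter] at hc'
      ext c
      simp only [Finset.mem_filter]
      constructor
      · rintro ⟨a, b, -⟩
        exact ⟨a, b⟩
      · rintro ⟨a, b⟩
        refine ⟨a, b, ?_⟩
        have := hlt c a c' hc'.1 (by rw [b, hc'.2.1]; exact h)
        omega
    rw [h2, hrow]
    exact lt_of_le_of_lt h1 (hdec i i' h (by omega))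
  have hone : ∀ k, (D.filter fun c => e c = k).card ≤ 1 := fun k =>
    Finset.card_le_one.2 fun a ha b hb => by
      simp only [Finset.mem_filter] at ha hb
      exact hinj a ha.1 b hb.1 (by omega)
  refine ⟨⟨e, ?_, ?_, ?_, ?_, ?_, ?_, ?_⟩⟩
  · intro c hc
    rw [he c hc]
    omega
  · intro c hc
    exact if_neg hc
  · intro i j₁ j₂ h h1 h2
    rw [he _ h1, he _ h2]
    dsimp only
    omega
  · intro c hc
    have h1 := hone (e c)
    have h2 : 0 < (D.filter fun c' => e c' = e c).card :=
      Finset.card_pos.2 ⟨c, by simp [hc, D]⟩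
    have h3 : (D.filter fun c' => e c' = e c).card = 1 := by omega
    change Odd (D.filter fun c' => e c' = e c).card
    rw [h3]
    exact odd_one
  · intro k _
    exact (Finset.card_image_le.trans (hone k)).trans one_le_two
  · intro k _ c hc c' hc' h1 h2 hne
    exact absurd (congrArg Prod.fst (hinj c hc c' hc' (by omega))) hne
  · intro k i i' hne h0 heq
    rcases Nat.lt_or_gt_of_ne hne with h | h
    · exact absurd heq (hkey k i i' h (heq ▸ h0)).ne'
    · exact absurd heq (hkey k i' i h h0).ne

end

/-! Let `o` and `e` be the numbers of odd and even parts of the strict partition, and `ℓ = o + e`.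
Both quantities in the theorem equal `max o (e + ℓ % 2)`; the algebraic side is
`isLeast_degree_schurQPoly`, the combinatorial side `srank_eq`.

Algebra. The power sums are algebraically independent (`aeval_powerSum_injective`), so it suffices
to study one explicit polynomial in them. Since `∑ q_n t^n = exp (2 ∑_{k odd} p_k t^k / k)`, only
odd power sums occur, and the length of every term has the parity of its weight. If the length of
the partition is odd, a zero part is appended without changing `Q`; the recurrence for even length
is then the expansion of a Pfaffian with entries `Q_(a,b)`. Every term of `Q_(a,b)` has length at
least 1, and at least 2 if `a + b` is even. So a pair of opposite parity costs one factor and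
removes one odd and one even entry; a pair of equal parity costs two and removes two entries of one
kind. This gives the lower bound `max o e` for the padded list (`minLength_le_degree`).

Attainment requires a monomial that does not cancel. The quadratic part of `Q_(a,b)` has no index
beyond `a`, because two contributions cancel (`quadCoeff_qTwoPoly`). Let `x` be the first entry. If
there are positive entries of the other parity and `c` is the largest of them, then in terms of
least length the index `x + c` can arise only from the pair `(x, c)`. If all entries are even and
`c` is the second one, `p_{x-1} p_{c+1}` likewise forces the pair `(x, c)`. If all positive entries
are odd, every pairing contributes to `∏ p_a` the same number up to the sign of the pairing, and the
Pfaffian of an all-ones array is 1. Induction then gives `exists_degree_eq_minLength`.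

Tableaux. A bar has odd size and meets at most two rows, so it is odd in exactly one row, which owns
it. The number of bars that a row owns has the parity of its length. An odd row thus owns a bar; an
even row that owns none shares its first bar with an owner, and no two such rows share the same
owner. Counting, together with the parity of the number of bars, gives the lower bound
(`BarTableau.max_le_numBars`). An explicit tableau attains it (`exists_barTableau_numBars_le`). -/

noncomputable section

/-! ### Algebraic independence of the power sums -/

open Finset

/-- A surjective endomorphism of a noetherian ring is injective. -/
theorem RingHom.injective_of_surjective_endo {R : Type*} [CommRing R] [IsNoetherianRing R]
    (f : R →+* R) (hf : Function.Surjective f) : Function.Injective f := by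
  have hsurj : ∀ n, Function.Surjective (f^[n]) := fun n => hf.iterate n
  have hpow : ∀ n x, (f ^ n) x = f^[n] x := fun n x => by rw [RingHom.coe_pow]
  let K : ℕ →o Ideal R := ⟨fun n => RingHom.ker (f ^ n), by
    refine monotone_nat_of_le_succ fun n x hx => ?_
    rw [RingHom.mem_ker, hpow] at hx ⊢
    rw [Function.iterate_succ_apply', hx, map_zero]⟩
  obtain ⟨n, hn⟩ := monotone_stabilizes_iff_noetherian.2 ‹IsNoetherianRing R› K
  rw [injective_iff_map_eq_zero]
  intro x hx
  obtain ⟨y, rfl⟩ := hsurj n x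
  have h1 : y ∈ K (n + 1) := by
    change y ∈ RingHom.ker (f ^ (n + 1))
    rw [RingHom.mem_ker, hpow, Function.iterate_succ_apply', hx]
  rw [← hn (n + 1) (Nat.le_succ n)] at h1
  change y ∈ RingHom.ker (f ^ n) at h1
  rwa [RingHom.mem_ker, hpow] at h1

namespace MvPolynomial

/-- Newton's identities express `k e_k` through smaller `e_j` and the power sums `p_1, …, p_k`, and
`k` is invertible in `ℚ`. -/
theorem esymm_mem_adjoin_psum (n k : ℕ) (hk : k ≤ n) :
    esymm (Fin n) ℚ k ∈ Algebra.adjoin ℚ (Set.range fun i : Fin n => psum (Fin n) ℚ (i + 1)) := by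
  induction k using Nat.strong_induction_on with
  | _ k ih =>
    set S := Algebra.adjoin ℚ (Set.range fun i : Fin n => psum (Fin n) ℚ (i + 1))
    rcases Nat.eq_zero_or_pos k with rfl | hpos
    · rw [esymm_zero]; exact one_mem S
    · have h := mul_esymm_eq_sum (Fin n) ℚ k
      have hmem : (k : MvPolynomial (Fin n) ℚ) * esymm (Fin n) ℚ k ∈ S := by
        rw [h]
        refine mul_mem (pow_mem (neg_mem (one_mem S)) _) (sum_mem fun a ha => ?_)
        simp only [mem_filter, HasAntidiagonal.mem_antidiagonal] at ha
        refine mul_mem (mul_mem (pow_mem (neg_mem (one_mem S)) _) (ih _ ha.2 (by omega))) ?_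
        refine Algebra.subset_adjoin ⟨⟨a.2 - 1, by omega⟩, ?_⟩
        simp only
        congr 1
        omega
      have : esymm (Fin n) ℚ k = (k : ℚ)⁻¹ • ((k : MvPolynomial (Fin n) ℚ) * esymm (Fin n) ℚ k) := by
        have hk0 : (k : ℚ) ≠ 0 := by positivity
        rw [← map_natCast (C : ℚ →+* MvPolynomial (Fin n) ℚ), ← smul_eq_C_mul, smul_smul,
          inv_mul_cancel₀ hk0, one_smul]
      rw [this]
      exact S.smul_mem hmem _

/-- The power sums `p_1, …, p_n` in `n` variables are algebraically independent. -/
theorem aeval_psum_injective (n : ℕ) :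
    Function.Injective (aeval fun i : Fin n => psum (Fin n) ℚ (i + 1) :
      MvPolynomial (Fin n) ℚ → MvPolynomial (Fin n) ℚ) := by
  let ψ : MvPolynomial (Fin n) ℚ →ₐ[ℚ] symmetricSubalgebra (Fin n) ℚ :=
    aeval fun i => ⟨psum (Fin n) ℚ (i + 1), psum_isSymmetric (Fin n) ℚ _⟩
  have hψ : ∀ p, (ψ p).val = aeval (fun i : Fin n => psum (Fin n) ℚ (i + 1)) p := fun p =>
    (Subalgebra.mvPolynomial_aeval_coe _ _ _).symm
  let e := esymmAlgEquiv (R := ℚ) (Fin n) (Fintype.card_fin n)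
  have hsurj : Function.Surjective ψ := by
    intro x
    obtain ⟨p, rfl⟩ := e.surjective x
    have hx : (e p).val ∈ Algebra.adjoin ℚ (Set.range fun i : Fin n => psum (Fin n) ℚ (i + 1)) := by
      have : (e p).val = aeval (fun i : Fin n => esymm (Fin n) ℚ (i + 1)) p :=
        esymmAlgHom_apply p
      rw [this]
      have h2 : Algebra.adjoin ℚ (Set.range fun i : Fin n => esymm (Fin n) ℚ (i + 1)) ≤
          Algebra.adjoin ℚ (Set.range fun i : Fin n => psum (Fin n) ℚ (i + 1)) := by
        refine Algebra.adjoin_le ?_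
        rintro _ ⟨i, rfl⟩
        exact esymm_mem_adjoin_psum n _ i.isLt
      refine h2 ?_
      rw [Algebra.adjoin_range_eq_range_aeval]
      exact ⟨p, rfl⟩
    rw [Algebra.adjoin_range_eq_range_aeval] at hx
    obtain ⟨q, hq⟩ := hx
    exact ⟨q, Subtype.ext ((hψ q).trans hq)⟩
  -- After identification of the symmetric polynomials with a polynomial ring through the `e_k`, `ψ`
  -- is a surjective endomorphism of a noetherian ring, and injectivity follows from generation
  -- alone.
  have hinj := RingHom.injective_of_surjective_endo ((e.symm.toAlgHom.comp ψ).toRingHom)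
    (e.symm.surjective.comp hsurj)
  intro p q hpq
  refine hinj ?_
  have : ψ p = ψ q := Subtype.ext (by rw [hψ, hψ]; exact hpq)
  change e.symm (ψ p) = e.symm (ψ q)
  rw [this]

end MvPolynomial

theorem coeff_powerSum (k : ℕ+) (d : ℕ →₀ ℕ) : MvPowerSeries.coeff d (powerSum k) =
    ∑ i ∈ d.support, if d = Finsupp.single i (k : ℕ) then 1 else 0 := by
  open scoped MvPowerSeries.WithPiTopology in
  have h := (summable_powerSum k).hasSum.map (MvPowerSeries.coeff (R := ℚ) d)
    (MvPowerSeries.WithPiTopology.continuous_coeff ℚ d)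
  refine h.unique ?_
  have h2 : ∀ i ∉ d.support, (MvPowerSeries.coeff (R := ℚ) d ∘ fun i : ℕ =>
      (MvPowerSeries.X i : MvPowerSeries ℕ ℚ) ^ (k : ℕ)) i = 0 := by
    intro i hi
    rw [Function.comp_apply, coeff_X_pow_eq, if_neg]
    rintro rfl
    exact hi (by simp)
  have h3 := hasSum_sum_of_ne_finset_zero (L := .unconditional ℕ) h2
  simpa only [Function.comp_apply, coeff_X_pow_eq] using h3

/-- Setting `x_i = 0` for `i ≥ n` reduces a relation between power sums in infinitely many variables
to one in `n` variables. -/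
theorem killCompl_powerSum (n : ℕ) (k : ℕ+) :
    MvPowerSeries.killCompl (R := ℚ) (Fin.valEmbedding (n := n)) (powerSum k) =
      (MvPolynomial.psum (Fin n) ℚ k : MvPowerSeries (Fin n) ℚ) := by
  classical
  ext d
  rw [MvPowerSeries.coeff_killCompl, coeff_powerSum, MvPolynomial.coeff_coe, MvPolynomial.psum,
    MvPolynomial.coeff_sum, Finsupp.support_embDomain, sum_map]
  have : ∀ i : Fin n, (Finsupp.embDomain Fin.valEmbedding d =
      Finsupp.single (Fin.valEmbedding i) (k : ℕ)) ↔ Finsupp.single i (k : ℕ) = d := by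
    intro i
    rw [← Finsupp.embDomain_single, Finsupp.embDomain_inj, eq_comm]
  simp only [this, MvPolynomial.coeff_X_pow]
  refine sum_subset (subset_univ _) fun i _ hi => if_neg ?_
  rintro rfl
  exact hi (by simp)

/-- The power sums are algebraically independent. -/
theorem aeval_powerSum_injective : Function.Injective
    (MvPolynomial.aeval powerSum : MvPolynomial ℕ+ ℚ → MvPowerSeries ℕ ℚ) := by
  rw [injective_iff_map_eq_zero]
  intro F hF
  -- Only `p_1, …, p_n` occur in `F`, and these are already independent in `n` variables.
  let n := F.vars.sup (fun k : ℕ+ => (k : ℕ))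
  let f : Fin n → ℕ+ := fun i => ⟨i + 1, Nat.succ_pos _⟩
  obtain ⟨G, hG⟩ := MvPolynomial.exists_rename_eq_of_vars_subset_range F f (by
    intro i j h
    have := congrArg PNat.val h
    simp only [f, PNat.mk_coe] at this
    exact Fin.ext (by omega)) (by
    intro k hk
    have hk' : (k : ℕ) ≤ n := le_sup (f := fun k : ℕ+ => (k : ℕ)) hk
    refine ⟨⟨k - 1, by have := k.pos; omega⟩, PNat.eq ?_⟩
    have := k.pos
    simp only [f, PNat.mk_coe]
    omega)
  have h1 := congrArg (MvPowerSeries.killCompl (R := ℚ) (Fin.valEmbedding (n := n))) hF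
  rw [map_zero, ← hG, MvPolynomial.aeval_rename, ← AlgHom.comp_apply, MvPolynomial.comp_aeval] at h1
  have h2 : (fun i => MvPowerSeries.killCompl (R := ℚ) (Fin.valEmbedding (n := n))
      ((powerSum ∘ f) i)) = fun i : Fin n => MvPolynomial.coeToMvPowerSeries.algHom (R := ℚ) ℚ
        (MvPolynomial.psum (Fin n) ℚ (i + 1)) := by
    ext1 i
    rw [Function.comp_apply, killCompl_powerSum]
    simp [f]
  rw [h2, ← MvPolynomial.comp_aeval, AlgHom.comp_apply] at h1
  have h3 : MvPolynomial.aeval (fun i : Fin n => MvPolynomial.psum (Fin n) ℚ (i + 1)) G = 0 := by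
    apply MvPolynomial.coe_injective
    simpa using h1
  rw [← hG, (injective_iff_map_eq_zero _).1 (MvPolynomial.aeval_psum_injective n) G h3, map_zero]

end

/-! ### The functions `q_n` as polynomials in the odd power sums -/

noncomputable section

open Finset

theorem coeff_powerSum_mul (k : ℕ+) (f : MvPowerSeries ℕ ℚ) (d : ℕ →₀ ℕ) :
    MvPowerSeries.coeff d (powerSum k * f) = ∑ j ∈ d.support,
      if (k : ℕ) ≤ d j then MvPowerSeries.coeff (d - Finsupp.single j (k : ℕ)) f else 0 := by
  have hc : ∀ j, MvPowerSeries.coeff d ((MvPowerSeries.X j : MvPowerSeries ℕ ℚ) ^ (k : ℕ) * f) =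
      if (k : ℕ) ≤ d j then MvPowerSeries.coeff (d - Finsupp.single j (k : ℕ)) f else 0 := by
    intro j
    rw [MvPowerSeries.X_pow_eq, MvPowerSeries.coeff_monomial_mul, one_mul]
    simp
  open scoped MvPowerSeries.WithPiTopology in
  have h := ((summable_powerSum k).hasSum.mul_right f).map (MvPowerSeries.coeff (R := ℚ) d)
    (MvPowerSeries.WithPiTopology.continuous_coeff ℚ d)
  refine h.unique ?_
  have h2 : ∀ i ∉ d.support, (MvPowerSeries.coeff (R := ℚ) d ∘ fun i : ℕ =>
      (MvPowerSeries.X i : MvPowerSeries ℕ ℚ) ^ (k : ℕ) * f) i = 0 := by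
    intro i hi
    rw [Function.comp_apply, hc, if_neg]
    have := k.pos
    simp only [Finsupp.mem_support_iff, not_not] at hi
    omega
  have h3 := hasSum_sum_of_ne_finset_zero (L := .unconditional ℕ) h2
  simpa only [Function.comp_apply, hc] using h3

theorem sum_range_even (m : ℕ) (c : ℚ) :
    (∑ i ∈ range m, if Even i then 2 * c else 0) = (m + (if Even m then 0 else 1)) * c := by
  induction m with
  | zero => simp
  | succ m ih =>
    rw [sum_range_succ, ih]
    by_cases h : Even m
    · have h' : ¬ Even (m + 1) := by rwa [Nat.even_add_one, not_not]
      rw [if_pos h, if_pos h, if_neg h']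
      push_cast; ring
    · have h' : Even (m + 1) := by rwa [Nat.even_add_one]
      rw [if_neg h, if_neg h, if_pos h']
      push_cast; ring

/-- The contribution of one variable with exponent `m` to the recurrence for the `q_n`. Taking away
an odd power `i + 1 ≤ m` of the variable leaves the coefficient `2c = 2 ^ s`, except that `i + 1 =
m` removes the variable and halves it. For either parity of `m` the total is `m * c`. -/
theorem sum_range_even_of_le (m n : ℕ) (hmn : m ≤ n) (c : ℚ) :
    (∑ i ∈ range n, if Even i then
      (if i + 1 ≤ m then (if i + 1 = m then c else 2 * c) else 0) else 0) = m * c := by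
  have hsub : range m ⊆ range n := range_subset_range.2 hmn
  rw [← sum_subset hsub (by
    intro i _ hi
    have : ¬ i + 1 ≤ m := by simpa using hi
    simp [this])]
  cases m with
  | zero => simp
  | succ m =>
    have hc : ∀ i ∈ range m, (if Even i then
        (if i + 1 ≤ m + 1 then (if i + 1 = m + 1 then c else 2 * c) else 0) else 0) =
        if Even i then 2 * c else 0 := by
      intro i hi
      rw [mem_range] at hi
      rw [if_pos (show i + 1 ≤ m + 1 by omega), if_neg (show i + 1 ≠ m + 1 by omega)]
    rw [sum_range_succ, sum_congr rfl hc, sum_range_even]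
    by_cases h : Even m
    · simp [h]; ring
    · simp [h]

theorem natCast_add_one_eq_C (n : ℕ) :
    (n : MvPowerSeries ℕ ℚ) + 1 = MvPowerSeries.C ((n : ℚ) + 1) := by
  rw [map_add, map_natCast, map_one]

/-- The recurrence for the `q_n` from the logarithmic derivative of their generating function. -/
theorem succ_mul_qFun_succ (n : ℕ) : ((n : MvPowerSeries ℕ ℚ) + 1) * qFun (n + 1) =
    2 * ∑ i ∈ range (n + 1), if Even i then powerSum i.succPNat * qFun (n - i) else 0 := by
  classical
  ext d
  have hl : ((n : MvPowerSeries ℕ ℚ) + 1) = MvPowerSeries.C ((n : ℚ) + 1) := natCast_add_one_eq_C n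
  have h2 : (2 : MvPowerSeries ℕ ℚ) = MvPowerSeries.C (2 : ℚ) := (map_ofNat _ 2).symm
  rw [hl, h2, MvPowerSeries.coeff_C_mul, MvPowerSeries.coeff_C_mul, coeff_qFun, map_sum]
  set s := d.support.card with hs
  have hterm : ∀ i ∈ range (n + 1), MvPowerSeries.coeff d
      (if Even i then powerSum i.succPNat * qFun (n - i) else 0) =
      ∑ j ∈ d.support, if Even i then (if i + 1 ≤ d j then (if i + 1 = d j then
        (if d.degree = n + 1 then (2 : ℚ) ^ (s - 1) else 0) else
        2 * (if d.degree = n + 1 then (2 : ℚ) ^ (s - 1) else 0)) else 0) else 0 := by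
    intro i hi
    rw [mem_range] at hi
    by_cases he : Even i
    swap
    · simp [he]
    simp only [if_pos he]
    rw [coeff_powerSum_mul]
    refine sum_congr rfl fun j hj => ?_
    rw [Nat.succPNat_coe, Nat.succ_eq_add_one]
    by_cases hle : i + 1 ≤ d j
    swap
    · rw [if_neg hle, if_neg hle]
    rw [if_pos hle, if_pos hle, coeff_qFun]
    have hle' : Finsupp.single j (i + 1) ≤ d := Finsupp.single_le_iff.2 hle
    have hdeg : (d - Finsupp.single j (i + 1)).degree + (i + 1) = d.degree := by
      conv_rhs => rw [← tsub_add_cancel_of_le hle', map_add, Finsupp.degree_single]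
    have hiff : (d - Finsupp.single j (i + 1)).degree = n - i ↔ d.degree = n + 1 := by omega
    simp only [hiff]
    have hs0 : 0 < s := card_pos.2 ⟨j, hj⟩
    by_cases heq : i + 1 = d j
    · have hsupp : (d - Finsupp.single j (i + 1)).support = d.support.erase j := by
        ext l
        by_cases hl : l = j
        · subst hl; simp [heq]
        · simp [hl]
      rw [if_pos heq, hsupp, card_erase_of_mem hj]
    · have hsupp : (d - Finsupp.single j (i + 1)).support = d.support := by
        ext l
        by_cases hl : l = j
        · subst hl
          simp
          omega
        · simp [Ne.symm hl]
      rw [if_neg heq, hsupp, mul_ite, mul_zero, ← pow_succ', Nat.sub_add_cancel hs0]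
  -- With the sum over the variables outside, the variable `j` contributes `d j * 2 ^ (s - 1)`, and
  -- the exponents `d j` add up to `n + 1`.
  rw [sum_congr rfl hterm, sum_comm]
  by_cases hd : d.degree = n + 1
  · simp only [if_pos hd]
    have hle : ∀ j ∈ d.support, d j ≤ n + 1 := fun j _ => hd ▸ Finsupp.le_degree j d
    rw [sum_congr rfl fun j hj => sum_range_even_of_le (d j) (n + 1) (hle j hj) ((2 : ℚ) ^ (s - 1)),
      ← sum_mul]
    have hsum : (∑ j ∈ d.support, (d j : ℚ)) = n + 1 := by
      rw [← Nat.cast_sum]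
      have : ∑ j ∈ d.support, d j = n + 1 := hd
      rw [this]; push_cast; rfl
    have hs0 : 0 < s := by
      refine card_pos.2 (Finsupp.support_nonempty_iff.2 ?_)
      rintro rfl
      simp at hd
    rw [hsum]
    conv_lhs => rw [← Nat.sub_add_cancel hs0, pow_succ']
    ring
  · simp [hd]

theorem qFun_zero : qFun 0 = 1 := by
  classical
  ext d
  rw [coeff_qFun, MvPowerSeries.coeff_one]
  by_cases h : d = 0
  · simp [h]
  · rw [if_neg h, if_neg (by rwa [Finsupp.degree_eq_zero_iff])]

/-- The polynomial in the power sums that expresses `q_n`. -/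
def qPoly : ℕ → MvPolynomial ℕ+ ℚ
  | 0 => 1
  | n + 1 => MvPolynomial.C (2 / ((n : ℚ) + 1)) * ∑ i : Fin (n + 1),
      if Even (i : ℕ) then MvPolynomial.X (i : ℕ).succPNat * qPoly (n - i) else 0

theorem qPoly_succ (n : ℕ) : qPoly (n + 1) = MvPolynomial.C (2 / ((n : ℚ) + 1)) *
    ∑ i ∈ range (n + 1), if Even i then MvPolynomial.X i.succPNat * qPoly (n - i) else 0 := by
  rw [qPoly, Fin.sum_univ_eq_sum_range (fun i => if Even i then
    MvPolynomial.X (R := ℚ) i.succPNat * qPoly (n - i) else 0)]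

theorem aeval_qPoly (n : ℕ) : MvPolynomial.aeval powerSum (qPoly n) = qFun n := by
  induction n using Nat.strong_induction_on with
  | _ n ih =>
    cases n with
    | zero => rw [qPoly, map_one, qFun_zero]
    | succ n =>
      have hc : (MvPowerSeries.C ((n : ℚ) + 1)⁻¹ : MvPowerSeries ℕ ℚ) * (n + 1) = 1 := by
        have : ((n : MvPowerSeries ℕ ℚ) + 1) = MvPowerSeries.C ((n : ℚ) + 1) := natCast_add_one_eq_C n
        rw [this, ← map_mul, inv_mul_cancel₀ (by positivity), map_one]
      have h := succ_mul_qFun_succ n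
      calc MvPolynomial.aeval powerSum (qPoly (n + 1))
          = MvPowerSeries.C ((n : ℚ) + 1)⁻¹ * (2 * ∑ i ∈ range (n + 1),
            if Even i then powerSum i.succPNat * qFun (n - i) else 0) := by
            rw [qPoly_succ, map_mul, map_sum, ← mul_assoc]
            congr 1
            · rw [MvPolynomial.aeval_C, div_eq_mul_inv, mul_comm, map_mul]
              rw [MvPowerSeries.algebraMap_apply, MvPowerSeries.algebraMap_apply]
              simp only [Algebra.algebraMap_self, RingHom.id_apply]
              rw [map_ofNat MvPowerSeries.C 2]
            · refine sum_congr rfl fun i _ => ?_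
              split_ifs
              · rw [map_mul, MvPolynomial.aeval_X, ih _ (by omega)]
              · rw [map_zero]
        _ = qFun (n + 1) := by rw [← h, ← mul_assoc, hc, one_mul]

end

/-! ### Alternating sums over lists, and Schur's recurrences in the polynomial ring -/

noncomputable section

open Finset

section AltSum

variable {α M N : Type*} [AddCommGroup M] [AddCommGroup N]

/-- The alternating sum of `f y r` over all ways to take one entry `y` out of a list, where `r`
is the list that remains. -/
def altSum (f : α → List α → M) : List α → M
  | [] => 0
  | a :: t => f a t - altSum (fun x r => f x (a :: r)) t

/-- Replaces the sums over positions in Schur's recurrences by a recursion on the list, so that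
signs are handled by induction without index arithmetic. -/
theorem sum_eraseIdx_eq_altSum {R : Type*} [CommRing R] (f : α → List α → R) (l : List α) :
    ∑ m : Fin l.length, (-1) ^ (m : ℕ) * f (l.get m) (l.eraseIdx m) = altSum f l := by
  induction l generalizing f with
  | nil => simp [altSum]
  | cons a t ih =>
    have h : ∑ m : Fin (a :: t).length, (-1) ^ (m : ℕ) * f ((a :: t).get m) ((a :: t).eraseIdx m) =
        ∑ m : Fin (t.length + 1),
          (-1) ^ (m : ℕ) * f ((a :: t).get m) ((a :: t).eraseIdx m) := rfl
    rw [altSum, ← ih, h, Fin.sum_univ_succ, sub_eq_add_neg, ← sum_neg_distrib]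
    congr 1
    · simp
    · refine sum_congr rfl fun m _ => ?_
      simp [pow_succ]

theorem altSum_congr {f g : α → List α → M} {l : List α}
    (h : ∀ y r, (y :: r).Perm l → r.Sublist l → f y r = g y r) : altSum f l = altSum g l := by
  induction l generalizing f g with
  | nil => rfl
  | cons a t ih =>
    rw [altSum, altSum, h a t (List.Perm.refl _) (List.sublist_cons_self a t)]
    congr 1
    exact ih fun y r hp hs => h y (a :: r)
      ((List.Perm.swap a y r).trans (hp.cons a)) (hs.cons_cons a)

theorem altSum_sub (f g : α → List α → M) (l : List α) :
    altSum (fun y r => f y r - g y r) l = altSum f l - altSum g l := by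
  induction l generalizing f g with
  | nil => simp [altSum]
  | cons a t ih => rw [altSum, altSum, altSum, ih]; abel

theorem map_altSum (φ : M →+ N) (f : α → List α → M) (l : List α) :
    φ (altSum f l) = altSum (fun y r => φ (f y r)) l := by
  induction l generalizing f with
  | nil => simp [altSum]
  | cons a t ih => rw [altSum, altSum, map_sub, ih]

theorem mul_altSum {R : Type*} [Ring R] (c : R) (f : α → List α → R) (l : List α) :
    c * altSum f l = altSum (fun y r => c * f y r) l :=
  map_altSum (AddMonoidHom.mulLeft c) f l

theorem altSum_zero (l : List α) : altSum (fun _ _ => (0 : M)) l = 0 := by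
  induction l with
  | nil => rfl
  | cons a t ih => rw [altSum, ih, sub_zero]

theorem exists_of_altSum_ne_zero {f : α → List α → M} {l : List α} (h : altSum f l ≠ 0) :
    ∃ y r, (y :: r).Perm l ∧ r.Sublist l ∧ f y r ≠ 0 := by
  by_contra! hc
  exact h ((altSum_congr hc).trans (altSum_zero l))

/-- If only the term of one entry `c` of a list without repetitions is nonzero, the alternating
sum is that term, up to sign. -/
theorem altSum_ne_zero_of_unique {f : α → List α → M} {l : List α} (hl : l.Nodup) {c : α}
    (hc : c ∈ l) (h0 : ∀ y r, (y :: r).Perm l → r.Sublist l → y ≠ c → f y r = 0)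
    (h1 : ∀ r, (c :: r).Perm l → r.Sublist l → f c r ≠ 0) : altSum f l ≠ 0 := by
  induction l generalizing f with
  | nil => simp at hc
  | cons a t ih =>
    rw [List.nodup_cons] at hl
    have hext : ∀ y r, (y :: r).Perm t → r.Sublist t →
        (y :: a :: r).Perm (a :: t) ∧ (a :: r).Sublist (a :: t) := fun y r hp hs =>
      ⟨(List.Perm.swap a y r).trans (hp.cons a), hs.cons_cons a⟩
    rw [altSum]
    by_cases hac : c = a
    · subst hac
      have : altSum (fun x r => f x (c :: r)) t = 0 := by
        rw [← altSum_zero t]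
        refine altSum_congr fun y r hp hs => h0 y _ (hext y r hp hs).1 (hext y r hp hs).2 ?_
        rintro rfl
        exact hl.1 (hp.subset (by simp))
      rw [this, sub_zero]
      exact h1 t (List.Perm.refl _) (List.sublist_cons_self _ _)
    · rw [h0 a t (List.Perm.refl _) (List.sublist_cons_self _ _) (Ne.symm hac), zero_sub,
        neg_ne_zero]
      have hct : c ∈ t := (List.mem_cons.1 hc).resolve_left hac
      exact ih hl.2 hct (fun y r hp hs => h0 y _ (hext y r hp hs).1 (hext y r hp hs).2)
        fun r hp hs => h1 _ (hext c r hp hs).1 (hext c r hp hs).2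

theorem altSum_append_singleton (f : α → List α → M) (l : List α) (z : α) :
    altSum f (l ++ [z]) = altSum (fun y r => f y (r ++ [z])) l + (-1 : ℤ) ^ l.length • f z l := by
  induction l generalizing f with
  | nil => simp [altSum]
  | cons a t ih =>
    rw [List.cons_append, altSum, ih, altSum, List.length_cons, pow_succ]
    simp only [List.cons_append, mul_neg, mul_one, neg_smul]
    abel

/-- Taking two entries out of a list in the opposite order changes the sign, as with two successive
contractions of an alternating form. -/
theorem altSum_altSum_swap (g : α → α → List α → M) (l : List α) :
    altSum (fun x r => altSum (fun y s => g x y s) r) l =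
      -altSum (fun x r => altSum (fun y s => g y x s) r) l := by
  induction l generalizing g with
  | nil => simp [altSum]
  | cons a t ih =>
    simp only [altSum, altSum_sub]
    rw [ih]
    abel

theorem altSum_const_of_even (c : M) (l : List α) (hl : Even l.length) :
    altSum (fun _ _ => c) l = 0 := by
  induction l using List.twoStepInduction with
  | nil => rfl
  | singleton => simp at hl
  | cons_cons a b t ih _ =>
    rw [altSum, altSum, ih (by simpa [Nat.even_add_one] using hl)]
    abel

/-- The signs cancel in pairs except for one. This is the expansion step showing that a Pfaffian of
ones equals 1; it is used when all pairings contribute alike. -/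
theorem altSum_const_of_odd (c : M) (l : List α) (hl : Odd l.length) :
    altSum (fun _ _ => c) l = c := by
  cases l with
  | nil => simp at hl
  | cons a t =>
    rw [altSum, altSum_const_of_even c t (by
      rw [List.length_cons, Nat.odd_add_one, Nat.not_odd_iff_even] at hl
      exact hl), sub_zero]

end AltSum

/-- The polynomial in the power sums that expresses `Q_{(a,b)}`. -/
def qTwoPoly (a b : ℕ) : MvPolynomial ℕ+ ℚ :=
  qPoly a * qPoly b + 2 * ∑ m ∈ Icc 1 b, (-1) ^ m * (qPoly (a + m) * qPoly (b - m))

theorem aeval_qTwoPoly (a b : ℕ) :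
    MvPolynomial.aeval powerSum (qTwoPoly a b) = schurQTwo a b := by
  simp only [qTwoPoly, schurQTwo, map_add, map_mul, map_sum, map_pow, map_neg, map_one,
    aeval_qPoly, map_ofNat]

theorem qTwoPoly_zero_right (a : ℕ) : qTwoPoly a 0 = qPoly a := by
  simp [qTwoPoly, qPoly]

/-- The polynomial in the power sums that expresses Schur's `Q`-function. -/
def schurQPoly : List ℕ → MvPolynomial ℕ+ ℚ
  | [] => 1
  | a :: t =>
    if Odd (a :: t).length then
      ∑ m : Fin (a :: t).length,
        (-1) ^ (m : ℕ) * (qPoly ((a :: t).get m) * schurQPoly ((a :: t).eraseIdx m))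
    else
      ∑ m : Fin t.length,
        (-1) ^ (m : ℕ) * (qTwoPoly a (t.get m) * schurQPoly (t.eraseIdx m))
termination_by l => l.length
decreasing_by
  · have := m.isLt
    rw [List.length_eraseIdx_of_lt m.isLt]
    simp
  · have := m.isLt
    rw [List.length_eraseIdx_of_lt m.isLt]
    simp only [List.length_cons]
    omega

theorem aeval_schurQPoly (l : List ℕ) :
    MvPolynomial.aeval powerSum (schurQPoly l) = schurQ l := by
  induction hn : l.length using Nat.strong_induction_on generalizing l with
  | _ n ih =>
    subst hn
    cases l with
    | nil => rw [schurQPoly, schurQ, map_one]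
    | cons a t =>
      rw [schurQPoly, schurQ]
      have h1 : ∀ m : Fin (a :: t).length, ((a :: t).eraseIdx m).length < (a :: t).length := by
        intro m
        rw [List.length_eraseIdx_of_lt m.isLt]
        simp
      have h2 : ∀ m : Fin t.length, (t.eraseIdx m).length < (a :: t).length := by
        intro m
        rw [List.length_eraseIdx_of_lt m.isLt, List.length_cons]
        omega
      split_ifs <;> rw [map_sum] <;> refine sum_congr rfl fun m _ => ?_
      · rw [map_mul, map_pow, map_neg, map_one, map_mul, aeval_qPoly, ih _ (h1 m) _ rfl]
      · rw [map_mul, map_pow, map_neg, map_one, map_mul, aeval_qTwoPoly, ih _ (h2 m) _ rfl]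

theorem schurQPoly_nil : schurQPoly [] = 1 := by rw [schurQPoly]

theorem schurQPoly_of_odd (l : List ℕ) (hl : Odd l.length) :
    schurQPoly l = altSum (fun y r => qPoly y * schurQPoly r) l := by
  cases l with
  | nil => simp at hl
  | cons a t => rw [schurQPoly, if_pos hl, ← sum_eraseIdx_eq_altSum]

theorem schurQPoly_cons (a : ℕ) (t : List ℕ) (ht : Odd t.length) :
    schurQPoly (a :: t) = altSum (fun y r => qTwoPoly a y * schurQPoly r) t := by
  have : ¬ Odd (a :: t).length := by rwa [List.length_cons, Nat.odd_add_one, not_not]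
  rw [schurQPoly, if_neg this, ← sum_eraseIdx_eq_altSum]

/-- A list of odd length may be padded with a zero. -/
theorem schurQPoly_append_zero (l : List ℕ) (hl : Odd l.length) :
    schurQPoly (l ++ [0]) = schurQPoly l := by
  induction hn : l.length using Nat.strong_induction_on generalizing l with
  | _ n ih =>
    subst hn
    cases l with
    | nil => simp at hl
    | cons x t =>
      have ht : Even t.length := by
        rwa [List.length_cons, Nat.odd_add_one, Nat.not_odd_iff_even] at hl
      have hlen : ∀ (y : ℕ) (r : List ℕ), (y :: r).Perm t → r.length + 1 = t.length :=
        fun y r hp => hp.length_eq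
      have hodd : ∀ (y : ℕ) (r : List ℕ), (y :: r).Perm t → Odd r.length := fun y r hp => by
        have := hlen y r hp
        rw [← Nat.not_even_iff_odd]
        intro h
        rw [← this, Nat.even_add_one] at ht
        exact ht h
      -- The term that removes the appended zero gives `q_x Q_t`, the first term of the odd
      -- recurrence. The remaining terms on both sides become double alternating sums over `t` that
      -- differ by an exchange of the two removed entries, which accounts for the minus sign in
      -- `altSum`.
      have h1 : altSum (fun y r => qTwoPoly x y * schurQPoly (r ++ [0])) t =
          altSum (fun y r => altSum (fun z s => qTwoPoly x y * (qPoly z * schurQPoly s)) r) t := by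
        refine altSum_congr fun y r hp hs => ?_
        have := hlen y r hp
        rw [ih r.length (by simp only [List.length_cons]; omega) r (hodd y r hp) rfl,
          schurQPoly_of_odd r (hodd y r hp), mul_altSum]
      have h2 : altSum (fun y r => qPoly y * schurQPoly (x :: r)) t =
          altSum (fun y r => altSum (fun z s => qTwoPoly x z * (qPoly y * schurQPoly s)) r) t := by
        refine altSum_congr fun y r hp hs => ?_
        rw [schurQPoly_cons x r (hodd y r hp), mul_altSum]
        exact altSum_congr fun z s _ _ => by ring
      rw [List.cons_append, schurQPoly_cons x (t ++ [0]) (by simpa using ht.add_one),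
        altSum_append_singleton, ht.neg_one_pow, one_smul, qTwoPoly_zero_right,
        schurQPoly_of_odd (x :: t) hl, altSum, h1, h2, altSum_altSum_swap]
      ring

end

/-! ### Linear and quadratic parts of `q_n` and `Q_(a,b)` -/

noncomputable section

open Finset

namespace MvPolynomial

variable {σ : Type*} {R : Type*} [CommRing R]

/-- The coefficient of a variable. -/
def linCoeff (i : σ) : MvPolynomial σ R →ₗ[R] R := lcoeff R 0 ∘ₗ (pderiv i).toLinearMap

/-- The second partial derivative at the origin. -/
def quadCoeff (i j : σ) : MvPolynomial σ R →ₗ[R] R :=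
  lcoeff R 0 ∘ₗ (pderiv i).toLinearMap ∘ₗ (pderiv j).toLinearMap

theorem linCoeff_apply (i : σ) (F : MvPolynomial σ R) :
    linCoeff i F = constantCoeff (pderiv i F) := rfl

theorem quadCoeff_apply (i j : σ) (F : MvPolynomial σ R) :
    quadCoeff i j F = constantCoeff (pderiv i (pderiv j F)) := rfl

theorem linCoeff_eq (i : σ) (F : MvPolynomial σ R) :
    linCoeff i F = coeff (Finsupp.single i 1) F := by
  rw [linCoeff_apply, constantCoeff_eq, coeff_pderiv]
  simp

/-- The last factor is 2 if `i = j` and 1 otherwise. Derivatives at the origin are preferred to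
coefficients because their product rule does not distinguish the case `i = j`. -/
theorem quadCoeff_eq (i j : σ) (F : MvPolynomial σ R) : quadCoeff i j F =
    coeff (Finsupp.single i 1 + Finsupp.single j 1) F * (Finsupp.single i 1 j + 1 : ℕ) := by
  rw [quadCoeff_apply, constantCoeff_eq, coeff_pderiv, coeff_pderiv]
  simp

theorem linCoeff_mul (i : σ) (F G : MvPolynomial σ R) : linCoeff i (F * G) =
    linCoeff i F * constantCoeff G + constantCoeff F * linCoeff i G := by
  simp only [linCoeff_apply, pderiv_mul, map_add, map_mul]

theorem quadCoeff_mul (i j : σ) (F G : MvPolynomial σ R) : quadCoeff i j (F * G) =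
    quadCoeff i j F * constantCoeff G + linCoeff i F * linCoeff j G + linCoeff j F * linCoeff i G
      + constantCoeff F * quadCoeff i j G := by
  simp only [quadCoeff_apply, linCoeff_apply, pderiv_mul, map_add, map_mul]
  ring

theorem linCoeff_X [DecidableEq σ] (i k : σ) :
    linCoeff i (X k : MvPolynomial σ R) = if k = i then 1 else 0 := by
  rw [linCoeff_apply, pderiv_X, Pi.single_apply]
  split_ifs <;> simp

theorem quadCoeff_X (i j k : σ) : quadCoeff i j (X k : MvPolynomial σ R) = 0 := by
  classical
  rw [quadCoeff_apply, pderiv_X, Pi.single_apply]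
  split_ifs <;> simp

end MvPolynomial

open MvPolynomial

theorem constantCoeff_qPoly (n : ℕ) : constantCoeff (qPoly n) = if n = 0 then 1 else 0 := by
  cases n with
  | zero => simp [qPoly]
  | succ n =>
    rw [qPoly_succ, if_neg (Nat.succ_ne_zero n), map_mul, map_sum, sum_eq_zero, mul_zero]
    intro i _
    split_ifs <;> simp

theorem succPNat_eq_iff (r : ℕ) (k : ℕ+) : r.succPNat = k ↔ r = (k : ℕ) - 1 := by
  rw [← PNat.coe_inj, Nat.succPNat_coe]
  have := k.pos
  omega

/-- Picks the term with `p_k` out of the recurrence for `qPoly`: it has `r = k - 1`, which is even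
exactly if `k` is odd. -/
theorem sum_range_ite_succPNat (n : ℕ) (k : ℕ+) (g : ℕ → ℚ) :
    (∑ r ∈ range (n + 1), if Even r then (if r.succPNat = k then g (n - r) else 0) else 0) =
      if Odd (k : ℕ) ∧ (k : ℕ) ≤ n + 1 then g (n + 1 - k) else 0 := by
  have hk := k.pos
  have h : ∀ r ∈ range (n + 1), (if Even r then (if r.succPNat = k then g (n - r) else 0) else 0) =
      if r = (k : ℕ) - 1 then (if Odd (k : ℕ) then g (n + 1 - k) else 0) else 0 := by
    intro r _
    simp only [succPNat_eq_iff]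
    by_cases hr : r = (k : ℕ) - 1
    · have h1 : Even r ↔ Odd (k : ℕ) := by
        rw [hr]
        rw [Nat.even_sub hk]
        simp
      have h2 : n - r = n + 1 - k := by omega
      rw [if_pos hr, if_pos hr, h2]
      simp only [h1]
    · rw [if_neg hr, if_neg hr, ite_self]
  rw [sum_congr rfl h, sum_ite_eq']
  simp only [mem_range]
  by_cases h1 : Odd (k : ℕ) <;> by_cases h2 : (k : ℕ) ≤ n + 1
  · rw [if_pos (by omega), if_pos h1, if_pos ⟨h1, h2⟩]
  · rw [if_neg (by omega), if_neg (by tauto)]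
  · rw [if_pos (by omega), if_neg h1, if_neg (by tauto)]
  · rw [if_neg (by omega), if_neg (by tauto)]

/-- The linear part of `exp (2 ∑_{k odd} p_k t^k / k)`. -/
theorem linCoeff_qPoly (k : ℕ+) (n : ℕ) :
    linCoeff k (qPoly n) = if n = k ∧ Odd (k : ℕ) then 2 / (k : ℚ) else 0 := by
  have hk := k.pos
  cases n with
  | zero =>
    rw [if_neg (by omega), qPoly, linCoeff_apply]
    simp
  | succ n =>
    have h : ∀ r ∈ range (n + 1), linCoeff k (if Even r then
        (X r.succPNat : MvPolynomial ℕ+ ℚ) * qPoly (n - r) else 0) =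
        if Even r then (if r.succPNat = k then (fun s => if s = 0 then (1 : ℚ) else 0) (n - r)
          else 0) else 0 := by
      intro r _
      split_ifs with h1 h2
      · rw [linCoeff_mul, linCoeff_X, if_pos h2, constantCoeff_qPoly]
        simp
      · rw [linCoeff_mul, linCoeff_X, if_neg h2]
        simp
      · exact map_zero _
    rw [qPoly_succ, linCoeff_mul, constantCoeff_C, map_sum (linCoeff k), sum_congr rfl h,
      sum_range_ite_succPNat n k fun s => if s = 0 then (1 : ℚ) else 0]
    have hC : linCoeff k (C (2 / ((n : ℚ) + 1)) : MvPolynomial ℕ+ ℚ) = 0 := by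
      rw [linCoeff_apply]; simp
    rw [hC, zero_mul, zero_add]
    by_cases h1 : n + 1 = k ∧ Odd (k : ℕ)
    · rw [if_pos h1, if_pos ⟨h1.2, h1.1.ge⟩, if_pos (by omega), ← h1.1]
      push_cast
      ring
    · rw [if_neg h1]
      split_ifs with h2 h3
      · exact absurd ⟨by omega, h2.1⟩ h1
      · ring
      · ring

/-- As for any exponential of a linear form, the second derivative is the product of the two first
derivatives. In the recurrence this appears as `2 / (i + j) * (2 / i + 2 / j) = 4 / (i j)`. -/
theorem quadCoeff_qPoly (i j : ℕ+) (n : ℕ) : quadCoeff i j (qPoly n) =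
    if n = (i : ℕ) + j ∧ Odd (i : ℕ) ∧ Odd (j : ℕ) then 4 / ((i : ℚ) * j) else 0 := by
  have hi := i.pos
  have hj := j.pos
  cases n with
  | zero =>
    rw [if_neg (by omega), qPoly, quadCoeff_apply]
    simp
  | succ n =>
    have h : ∀ r ∈ range (n + 1), quadCoeff i j (if Even r then
        (X r.succPNat : MvPolynomial ℕ+ ℚ) * qPoly (n - r) else 0) =
        (if Even r then (if r.succPNat = i then
          (fun s => if s = (j : ℕ) ∧ Odd (j : ℕ) then 2 / (j : ℚ) else 0) (n - r) else 0) else 0) +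
        if Even r then (if r.succPNat = j then
          (fun s => if s = (i : ℕ) ∧ Odd (i : ℕ) then 2 / (i : ℚ) else 0) (n - r) else 0) else 0 := by
      intro r _
      by_cases h1 : Even r
      · simp only [if_pos h1]
        rw [quadCoeff_mul, linCoeff_X, linCoeff_X, quadCoeff_X, constantCoeff_X, linCoeff_qPoly,
          linCoeff_qPoly]
        simp only [ite_mul, zero_mul, one_mul, zero_add, add_zero]
      · simp only [if_neg h1, map_zero, add_zero]
    have hC1 : ∀ k : ℕ+, linCoeff k (C (2 / ((n : ℚ) + 1)) : MvPolynomial ℕ+ ℚ) = 0 := by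
      intro k
      rw [linCoeff_apply]; simp
    have hC2 : quadCoeff i j (C (2 / ((n : ℚ) + 1)) : MvPolynomial ℕ+ ℚ) = 0 := by
      rw [quadCoeff_apply]; simp
    rw [qPoly_succ, quadCoeff_mul, constantCoeff_C, map_sum (quadCoeff i j), sum_congr rfl h,
      sum_add_distrib,     
      sum_range_ite_succPNat n i fun s => if s = (j : ℕ) ∧ Odd (j : ℕ) then 2 / (j : ℚ) else 0,
      sum_range_ite_succPNat n j fun s => if s = (i : ℕ) ∧ Odd (i : ℕ) then 2 / (i : ℚ) else 0,
      hC1, hC1, hC2]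
    simp only [zero_mul, zero_add]
    by_cases h1 : n + 1 = (i : ℕ) + j ∧ Odd (i : ℕ) ∧ Odd (j : ℕ)
    · have hn : (n : ℚ) + 1 = i + j := by exact_mod_cast h1.1
      have hi' : (i : ℚ) ≠ 0 := by positivity
      have hj' : (j : ℚ) ≠ 0 := by positivity
      have hij' : (i : ℚ) + j ≠ 0 := by positivity
      rw [if_pos h1, if_pos ⟨h1.2.1, by omega⟩, if_pos ⟨by omega, h1.2.2⟩,
        if_pos ⟨h1.2.2, by omega⟩, if_pos ⟨by omega, h1.2.1⟩, hn]
      field_simp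
      ring
    · rw [if_neg h1]
      have h2 : ∀ {p q : Prop} [Decidable p] [Decidable q] (c : ℚ), ¬ (p ∧ q) →
          (if p then (if q then c else 0) else 0) = 0 := by
        intro p q _ _ c hpq
        split_ifs with hp hq
        · exact absurd ⟨hp, hq⟩ hpq
        · rfl
        · rfl
      rw [h2 _ (by
        rintro ⟨⟨ha, hb⟩, hc, hd⟩
        exact h1 ⟨by omega, ha, hd⟩), h2 _ (by
        rintro ⟨⟨ha, hb⟩, hc, hd⟩
        exact h1 ⟨by omega, hd, ha⟩)]
      ring

/-- The bidegree of `p_k`: its degree as a symmetric function, and the parity of its length. -/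
def bidegree (k : ℕ+) : ℕ × ZMod 2 := (k, 1)

theorem weight_bidegree (m : ℕ+ →₀ ℕ) : Finsupp.weight bidegree m =
    (Finsupp.weight (fun k : ℕ+ => (k : ℕ)) m, (m.degree : ZMod 2)) := by
  induction m using Finsupp.induction_linear with
  | zero => simp only [map_zero, Nat.cast_zero]; rfl
  | add f g hf hg => rw [map_add, hf, hg, map_add, map_add]; simp
  | single k c =>
    simp [Finsupp.weight_single, bidegree]

/-- Each step of the recurrence multiplies by some `p_k` with `k` odd, which changes the parities of
weight and length together. -/
theorem isWeightedHomogeneous_qPoly (n : ℕ) :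
    IsWeightedHomogeneous bidegree (qPoly n) (n, (n : ZMod 2)) := by
  induction n using Nat.strong_induction_on with
  | _ n ih =>
    cases n with
    | zero =>
      rw [qPoly, Nat.cast_zero]
      exact isWeightedHomogeneous_one ℚ bidegree
    | succ n =>
      rw [qPoly_succ]
      refine IsWeightedHomogeneous.C_mul (IsWeightedHomogeneous.sum _ _ _ fun r hr => ?_) _
      rw [mem_range] at hr
      split_ifs with h
      · have h1 := (isWeightedHomogeneous_X ℚ bidegree r.succPNat).mul (ih (n - r) (by omega))
        convert h1 using 1
        ext
        · simp [bidegree]; omega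
        · obtain ⟨s, rfl⟩ := h
          have hn : n + 1 = 1 + (n - (s + s)) + (s + s) := by omega
          have h2 : ((s + s : ℕ) : ZMod 2) = 0 := by
            rw [ZMod.natCast_eq_zero_iff]; omega
          simp only [bidegree, Prod.snd_add]
          rw [hn, Nat.cast_add, h2, add_zero, Nat.cast_add, Nat.cast_one]
      · exact isWeightedHomogeneous_zero _ _ _

theorem isWeightedHomogeneous_qTwoPoly (a b : ℕ) :
    IsWeightedHomogeneous bidegree (qTwoPoly a b) (a + b, (a + b : ℕ)) := by
  have h : ∀ c d, c + d = a + b →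
      IsWeightedHomogeneous bidegree (qPoly c * qPoly d) (a + b, ((a + b : ℕ) : ZMod 2)) := by
    intro c d hcd
    convert (isWeightedHomogeneous_qPoly c).mul (isWeightedHomogeneous_qPoly d) using 1
    rw [← hcd, Prod.mk_add_mk, Nat.cast_add]
  rw [qTwoPoly]
  refine (h a b rfl).add ?_
  rw [← map_ofNat C 2]
  refine IsWeightedHomogeneous.C_mul (IsWeightedHomogeneous.sum _ _ _ fun m hm => ?_) _
  rw [mem_Icc] at hm
  have : ((-1) ^ m : MvPolynomial ℕ+ ℚ) = C ((-1) ^ m) := by simp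
  rw [this]
  exact (h _ _ (by omega)).C_mul _

theorem weight_eq_of_coeff_qTwoPoly_ne_zero {a b : ℕ} {m : ℕ+ →₀ ℕ}
    (h : coeff m (qTwoPoly a b) ≠ 0) :
    Finsupp.weight (fun k : ℕ+ => (k : ℕ)) m = a + b ∧ m.degree % 2 = (a + b) % 2 := by
  have h1 := isWeightedHomogeneous_qTwoPoly a b h
  rw [weight_bidegree, Prod.mk.injEq] at h1
  exact ⟨h1.1, (ZMod.natCast_eq_natCast_iff' _ _ 2).1 h1.2⟩

theorem two_mul_sum_qPoly (a b : ℕ) :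
    2 * ∑ m ∈ Icc 1 b, (-1) ^ m * (qPoly (a + m) * qPoly (b - m)) =
      ∑ m ∈ Icc 1 b, (2 * (-1) ^ m : ℚ) • (qPoly (a + m) * qPoly (b - m)) := by
  rw [mul_sum]
  refine sum_congr rfl fun m _ => ?_
  rw [smul_eq_C_mul, map_mul, map_ofNat C 2, map_pow, map_neg, map_one, mul_assoc]

/-- The linear part of `Q_{(a,b)}`. -/
theorem linCoeff_qTwoPoly (a b : ℕ) (ha : 0 < a) (k : ℕ+) (hk : (k : ℕ) = a + b)
    (hodd : Odd (k : ℕ)) :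
    linCoeff k (qTwoPoly a b) = (if b = 0 then 2 else 4 * (-1) ^ b) / (k : ℚ) := by
  -- A product has a linear part only if one factor has a constant term; as `a > 0`, this requires
  -- `b - m = 0`.
  have h : ∀ m, m ≤ b → linCoeff k (qPoly (a + m) * qPoly (b - m)) =
      if m = b then 2 / (k : ℚ) else 0 := by
    intro m hm
    rw [linCoeff_mul, linCoeff_qPoly, linCoeff_qPoly, constantCoeff_qPoly, constantCoeff_qPoly,
      if_neg (show a + m ≠ 0 by omega), zero_mul, add_zero]
    by_cases hmb : m = b
    · rw [if_pos ⟨by omega, hodd⟩, if_pos (by omega), if_pos hmb, mul_one]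
    · rw [if_neg (show ¬ (b - m = 0) by omega), mul_zero, if_neg hmb]
  have h0 := h 0 (Nat.zero_le b)
  rw [add_zero, Nat.sub_zero] at h0
  have hsum : linCoeff k (2 * ∑ m ∈ Icc 1 b, (-1) ^ m * (qPoly (a + m) * qPoly (b - m))) =
      if b = 0 then 0 else 4 * (-1) ^ b / (k : ℚ) := by
    rw [two_mul_sum_qPoly, map_sum]
    have hm : ∀ m ∈ Icc 1 b, linCoeff k ((2 * (-1) ^ m : ℚ) • (qPoly (a + m) * qPoly (b - m))) =
        if m = b then 4 * (-1) ^ b / (k : ℚ) else 0 := by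
      intro m hm
      rw [mem_Icc] at hm
      rw [map_smul, h m hm.2]
      split_ifs with h1
      · rw [h1, smul_eq_mul]; ring
      · rw [smul_zero]
    rw [sum_congr rfl hm, sum_ite_eq']
    by_cases hb : b = 0
    · simp [hb]
    · rw [if_pos (by rw [mem_Icc]; omega), if_neg hb]
  rw [qTwoPoly, map_add, h0, hsum]
  by_cases hb : b = 0
  · simp [hb]
  · rw [if_neg (Ne.symm hb), if_neg hb, if_neg hb, zero_add]

/-- The quadratic part of `Q_{(a,b)}`. -/
theorem quadCoeff_qTwoPoly (a b : ℕ) (hab : b < a) (i j : ℕ+) (hij : (i : ℕ) + j = a + b)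
    (hle : i ≤ j) (hi : Odd (i : ℕ)) (hj : Odd (j : ℕ)) :
    quadCoeff i j (qTwoPoly a b) = 4 / ((i : ℚ) * j) *
      if a < j then 0 else if (j : ℕ) = a then -1 else if b = 0 then 1 else 2 * (-1) ^ b := by
  have hi0 := i.pos
  have hle' : (i : ℕ) ≤ j := hle
  set c : ℚ := 4 / ((i : ℚ) * j) with hc
  -- There are two sources: the quadratic part of `q_{a+b}` if `m = b`, and the product of the
  -- linear parts of `q_j` and `q_i` if `a + m = j`. The assignment `a + m = i` is impossible, since
  -- `2 i ≤ a + b < 2 a`.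
  have h : ∀ m, m ≤ b → quadCoeff i j (qPoly (a + m) * qPoly (b - m)) =
      (if m = b then c else 0) + if a + m = (j : ℕ) then c else 0 := by
    intro m hm
    rw [quadCoeff_mul]
    simp only [quadCoeff_qPoly, linCoeff_qPoly, constantCoeff_qPoly]
    rw [if_neg (show ¬ (a + m = (i : ℕ) ∧ Odd (i : ℕ)) by omega),
      if_neg (show ¬ (a + m = 0) by omega), zero_mul, zero_mul, add_zero, add_zero]
    congr 1
    · by_cases hmb : m = b
      · rw [if_pos ⟨by omega, hi, hj⟩, if_pos (by omega), if_pos hmb, mul_one]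
      · rw [if_neg (show ¬ (b - m = 0) by omega), mul_zero, if_neg hmb]
    · by_cases hm' : a + m = j
      · rw [if_pos ⟨hm', hj⟩, if_pos ⟨by omega, hi⟩, if_pos hm', hc]
        field_simp
        norm_num
      · rw [if_neg (by tauto), if_neg hm', zero_mul]
  have h0 := h 0 (Nat.zero_le b)
  rw [add_zero, Nat.sub_zero] at h0
  have hsum : quadCoeff i j (2 * ∑ m ∈ Icc 1 b, (-1) ^ m * (qPoly (a + m) * qPoly (b - m))) =
      (if b = 0 then 0 else 2 * (-1) ^ b * c) +
        if a < (j : ℕ) then 2 * (-1) ^ ((j : ℕ) - a) * c else 0 := by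
    rw [two_mul_sum_qPoly, map_sum]
    have hm : ∀ m ∈ Icc 1 b,
        quadCoeff i j ((2 * (-1) ^ m : ℚ) • (qPoly (a + m) * qPoly (b - m))) =
        (if m = b then 2 * (-1) ^ b * c else 0) +
          if m = (j : ℕ) - a then 2 * (-1) ^ ((j : ℕ) - a) * c else 0 := by
      intro m hm
      rw [mem_Icc] at hm
      have hiff : a + m = (j : ℕ) ↔ m = (j : ℕ) - a := by omega
      rw [map_smul, h m hm.2, smul_add]
      simp only [hiff]
      congr 1
      · split_ifs with h1
        · rw [h1, smul_eq_mul]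
        · rw [smul_zero]
      · split_ifs with h1
        · rw [← h1, smul_eq_mul]
        · rw [smul_zero]
    rw [sum_congr rfl hm, sum_add_distrib, sum_ite_eq', sum_ite_eq']
    congr 1
    · by_cases hb : b = 0
      · simp [hb]
      · rw [if_pos (by rw [mem_Icc]; omega), if_neg hb]
    · have : (j : ℕ) - a ∈ Icc 1 b ↔ a < (j : ℕ) := by rw [mem_Icc]; omega
      simp only [this]
  rw [qTwoPoly, map_add, h0, hsum]
  rcases lt_trichotomy a (j : ℕ) with h1 | h1 | h1
  -- For `j > a` both sources occur, at `m = b` and `m = j - a`. These differ by the odd number `i`,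
  -- so the contributions cancel.
  · have hp : (-1 : ℚ) ^ ((j : ℕ) - a) = -(-1) ^ b := by
      have hb : b = (i : ℕ) + ((j : ℕ) - a) := by omega
      rw [hb, pow_add, hi.neg_one_pow]
      ring
    rw [if_pos h1, if_pos h1, if_neg (show ¬ (0 = b) by omega), if_neg (show ¬ (a = (j : ℕ)) by omega),
      if_neg (show b ≠ 0 by omega), hp]
    ring
  · have hb : (-1 : ℚ) ^ b = -1 := by
      have : b = i := by omega
      rw [this, hi.neg_one_pow]
    rw [if_neg (show ¬ (0 = b) by omega), if_pos h1, if_neg (show ¬ b = 0 by omega),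
      if_neg (show ¬ a < (j : ℕ) by omega), if_neg (show ¬ a < (j : ℕ) by omega),
      if_pos h1.symm, hb]
    ring
  · rw [if_neg (show ¬ a < (j : ℕ) by omega), if_neg (show ¬ a = (j : ℕ) by omega),
      if_neg (show ¬ a < (j : ℕ) by omega), if_neg (show ¬ (j : ℕ) = a by omega)]
    by_cases hb : b = 0
    · rw [if_pos hb.symm, if_pos hb, if_pos hb]
      ring
    · rw [if_neg (Ne.symm hb), if_neg hb, if_neg hb]
      ring

end

/-! ### Lower bound for the lengths of the terms, and terms of least length -/

noncomputable section

open Finset MvPolynomial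

theorem MvPolynomial.exists_add_of_coeff_mul_ne_zero {σ R : Type*} [CommSemiring R]
    {F G : MvPolynomial σ R} {m : σ →₀ ℕ} (h : coeff m (F * G) ≠ 0) :
    ∃ m₁ m₂, m₁ + m₂ = m ∧ coeff m₁ F ≠ 0 ∧ coeff m₂ G ≠ 0 := by
  classical
  rw [coeff_mul] at h
  obtain ⟨⟨m₁, m₂⟩, hm, hne⟩ := exists_ne_zero_of_sum_ne_zero h
  exact ⟨m₁, m₂, HasAntidiagonal.mem_antidiagonal.1 hm, left_ne_zero_of_mul hne, right_ne_zero_of_mul hne⟩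

theorem MvPolynomial.coeff_add_mul_of_unique {σ R : Type*} [CommSemiring R]
    {F G : MvPolynomial σ R} {a b : σ →₀ ℕ}
    (h : ∀ m₁ m₂, m₁ + m₂ = a + b → coeff m₁ F ≠ 0 → coeff m₂ G ≠ 0 → m₁ = a) :
    coeff (a + b) (F * G) = coeff a F * coeff b G := by
  classical
  rw [coeff_mul, sum_eq_single (a, b)]
  · rintro ⟨m₁, m₂⟩ hm hne
    rw [HasAntidiagonal.mem_antidiagonal] at hm
    by_contra hc
    have h1 := h m₁ m₂ hm (left_ne_zero_of_mul hc) (right_ne_zero_of_mul hc)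
    subst h1
    exact hne (Prod.ext rfl (add_left_cancel hm))
  · intro hn
    rw [HasAntidiagonal.mem_antidiagonal] at hn
    exact absurd rfl hn

theorem qPoly_mem_supported (n : ℕ) : qPoly n ∈ supported ℚ {k : ℕ+ | Odd (k : ℕ)} := by
  induction n using Nat.strong_induction_on with
  | _ n ih =>
    cases n with
    | zero => rw [qPoly]; exact one_mem _
    | succ n =>
      rw [qPoly_succ]
      refine mul_mem (Subalgebra.algebraMap_mem _ _) (sum_mem fun r _ => ?_)
      split_ifs with h
      · refine mul_mem ?_ (ih _ (by omega))
        rw [X_mem_supported]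
        exact h.add_one
      · exact zero_mem _

theorem odd_of_coeff_qTwoPoly_ne_zero {a b : ℕ} {m : ℕ+ →₀ ℕ} (h : coeff m (qTwoPoly a b) ≠ 0)
    {k : ℕ+} (hk : k ∈ m.support) : Odd (k : ℕ) := by
  have hmem : qTwoPoly a b ∈ supported ℚ {k : ℕ+ | Odd (k : ℕ)} := by
    have hq := qPoly_mem_supported
    refine add_mem (mul_mem (hq _) (hq _)) (mul_mem ?_ (sum_mem fun m _ => mul_mem
      (pow_mem (neg_mem (one_mem _)) _) (mul_mem (hq _) (hq _))))
    exact ofNat_mem _ 2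
  rw [mem_supported] at hmem
  exact hmem (mem_coe.2 ((mem_vars_iff_mem_support k).2 ⟨m, mem_support_iff.2 h, hk⟩))

@[simp]
theorem coe_toPNat (a : ℕ) (h : 0 < a) : ((a.toPNat h : ℕ+) : ℕ) = a := rfl

theorem exists_single_of_degree_eq_one {m : ℕ+ →₀ ℕ} (h : m.degree = 1) :
    ∃ k, m = Finsupp.single k 1 := by
  have h0 : m ≠ 0 := by
    rintro rfl
    simp at h
  obtain ⟨k, hk⟩ := Finsupp.support_nonempty_iff.2 h0
  have hle : Finsupp.single k 1 ≤ m := by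
    rw [Finsupp.single_le_iff]
    exact Nat.one_le_iff_ne_zero.2 (Finsupp.mem_support_iff.1 hk)
  have hsplit := tsub_add_cancel_of_le hle
  have hdeg := congrArg Finsupp.degree hsplit
  rw [map_add, Finsupp.degree_single, h] at hdeg
  have hz : m - Finsupp.single k 1 = 0 := (Finsupp.degree_eq_zero_iff _).1 (by omega)
  exact ⟨k, by rw [← hsplit, hz, zero_add]⟩

theorem exists_single_add_single_of_degree_eq_two {m : ℕ+ →₀ ℕ} (h : m.degree = 2) {k : ℕ+}
    (hk : k ∈ m.support) : ∃ j, m = Finsupp.single k 1 + Finsupp.single j 1 := by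
  have hle : Finsupp.single k 1 ≤ m := by
    rw [Finsupp.single_le_iff]
    exact Nat.one_le_iff_ne_zero.2 (Finsupp.mem_support_iff.1 hk)
  have hsplit := add_tsub_cancel_of_le hle
  have hdeg := congrArg Finsupp.degree hsplit
  rw [map_add, Finsupp.degree_single, h] at hdeg
  obtain ⟨j, hj⟩ := exists_single_of_degree_eq_one (m := m - Finsupp.single k 1) (by omega)
  exact ⟨j, by rw [← hj, hsplit]⟩

theorem le_weight_of_mem_support {m : ℕ+ →₀ ℕ} {k : ℕ+} (hk : k ∈ m.support) :
    (k : ℕ) ≤ Finsupp.weight (fun k : ℕ+ => (k : ℕ)) m :=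
  Finsupp.le_weight_of_ne_zero' _ (Finsupp.mem_support_iff.1 hk)

theorem weight_single_one (k : ℕ+) :
    Finsupp.weight (fun k : ℕ+ => (k : ℕ)) (Finsupp.single k 1) = k := by
  rw [Finsupp.weight_single, one_smul]

/-- Positive weight excludes the empty monomial, and length and weight have the same parity. The
bound is 1 for `a`, `b` of opposite parity and 2 for equal parity. -/
theorem le_degree_of_coeff_qTwoPoly_ne_zero {a b : ℕ} (hab : b < a) {m : ℕ+ →₀ ℕ}
    (h : coeff m (qTwoPoly a b) ≠ 0) : 2 - (a + b) % 2 ≤ m.degree := by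
  obtain ⟨h1, h2⟩ := weight_eq_of_coeff_qTwoPoly_ne_zero h
  have h3 : m.degree ≠ 0 := by
    rw [Ne, Finsupp.degree_eq_zero_iff]
    rintro rfl
    rw [map_zero] at h1
    omega
  omega

/-- The quadratic part of `Q_{(a,b)}` involves no power sums beyond `p_a`. -/
theorem le_of_coeff_qTwoPoly_ne_zero {a b : ℕ} (hab : b < a) {m : ℕ+ →₀ ℕ}
    (h : coeff m (qTwoPoly a b) ≠ 0) (hm : m.degree = 2) {k : ℕ+} (hk : k ∈ m.support) :
    (k : ℕ) ≤ a := by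
  by_contra hlt
  obtain ⟨i, rfl⟩ := exists_single_add_single_of_degree_eq_two hm hk
  have hw := (weight_eq_of_coeff_qTwoPoly_ne_zero h).1
  rw [map_add, weight_single_one, weight_single_one] at hw
  have hi : i ∈ (Finsupp.single k 1 + Finsupp.single i 1 : ℕ+ →₀ ℕ).support := by simp
  have hq := quadCoeff_qTwoPoly a b hab i k (by omega) (PNat.coe_le_coe _ _ |>.1 (by omega))
    (odd_of_coeff_qTwoPoly_ne_zero h hi) (odd_of_coeff_qTwoPoly_ne_zero h hk)
  rw [if_pos (by omega), mul_zero, quadCoeff_eq, add_comm (Finsupp.single i 1)] at hq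
  have : ((Finsupp.single i 1 k + 1 : ℕ) : ℚ) ≠ 0 := by positivity
  exact h ((mul_eq_zero.1 hq).resolve_right this)

/-- The number of odd entries. -/
def oddCount (l : List ℕ) : ℕ := l.countP fun a => a % 2 = 1

/-- The number of even entries. -/
def evenCount (l : List ℕ) : ℕ := l.countP fun a => a % 2 = 0

theorem oddCount_cons (a : ℕ) (l : List ℕ) : oddCount (a :: l) = oddCount l + a % 2 := by
  rw [oddCount, List.countP_cons, oddCount]
  rcases Nat.mod_two_eq_zero_or_one a with h | h <;> simp [h]

theorem evenCount_cons (a : ℕ) (l : List ℕ) :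
    evenCount (a :: l) = evenCount l + (1 - a % 2) := by
  rw [evenCount, List.countP_cons, evenCount]
  rcases Nat.mod_two_eq_zero_or_one a with h | h <;> simp [h]

theorem oddCount_add_evenCount (l : List ℕ) : oddCount l + evenCount l = l.length := by
  induction l with
  | nil => rfl
  | cons a t ih => rw [oddCount_cons, evenCount_cons, List.length_cons]; omega

theorem List.Perm.oddCount_eq {l l' : List ℕ} (h : l.Perm l') : oddCount l = oddCount l' :=
  h.countP_eq _

theorem List.Perm.evenCount_eq {l l' : List ℕ} (h : l.Perm l') : evenCount l = evenCount l' :=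
  h.countP_eq _

/-- The least length of a term in the power sum expansion of `Q_l`, for strictly decreasing lists
of even length. -/
def minLength (l : List ℕ) : ℕ := max (oddCount l) (evenCount l)

/-- The lists of even length that strictly decrease: strict partitions, padded with a zero if
their length is odd. -/
def IsPadded (l : List ℕ) : Prop := Even l.length ∧ l.Pairwise (· > ·)

section Remove

variable {x y : ℕ} {t r : List ℕ}

theorem IsPadded.odd_length_tail (h : IsPadded (x :: t)) : Odd t.length := by
  have := h.1
  rwa [List.length_cons, Nat.even_add_one, Nat.not_even_iff_odd] at this

theorem IsPadded.remove (h : IsPadded (x :: t)) (hp : (y :: r).Perm t) (hs : r.Sublist t) :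
    IsPadded r := by
  refine ⟨?_, (List.pairwise_cons.1 h.2).2.sublist hs⟩
  have h1 := h.1
  have h2 := hp.length_eq
  rw [List.length_cons] at h1 h2
  rw [Nat.even_iff] at h1 ⊢
  omega

theorem IsPadded.lt_head (h : IsPadded (x :: t)) {z : ℕ} (hz : z ∈ t) : z < x :=
  (List.pairwise_cons.1 h.2).1 z hz

theorem IsPadded.nodup_tail (h : IsPadded (x :: t)) : t.Nodup :=
  (List.pairwise_cons.1 h.2).2.imp fun h => ne_of_gt h

theorem mem_of_cons_perm (hp : (y :: r).Perm t) : y ∈ t := hp.subset (by simp)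

theorem oddCount_of_perm (hp : (y :: r).Perm t) :
    oddCount (x :: t) = oddCount r + y % 2 + x % 2 := by
  rw [oddCount_cons, ← hp.oddCount_eq, oddCount_cons]

theorem evenCount_of_perm (hp : (y :: r).Perm t) :
    evenCount (x :: t) = evenCount r + (1 - y % 2) + (1 - x % 2) := by
  rw [evenCount_cons, ← hp.evenCount_eq, evenCount_cons]

theorem coeff_schurQPoly_cons (h : IsPadded (x :: t)) (m : ℕ+ →₀ ℕ) :
    coeff m (schurQPoly (x :: t)) =
      altSum (fun y r => coeff m (qTwoPoly x y * schurQPoly r)) t := by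
  rw [schurQPoly_cons x t h.odd_length_tail]
  exact map_altSum (lcoeff ℚ m).toAddMonoidHom _ _

end Remove

/-- The lower bound for the lengths of the terms of `Q_l`. -/
theorem minLength_le_degree {l : List ℕ} (hl : IsPadded l) {m : ℕ+ →₀ ℕ}
    (hm : coeff m (schurQPoly l) ≠ 0) : minLength l ≤ m.degree := by
  induction hn : l.length using Nat.strong_induction_on generalizing l m with
  | _ n ih =>
    subst hn
    cases l with
    | nil => simp [minLength, oddCount, evenCount]
    | cons x t =>
      rw [coeff_schurQPoly_cons hl] at hm
      obtain ⟨y, r, hp, hs, hne⟩ := exists_of_altSum_ne_zero hm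
      obtain ⟨m₁, m₂, rfl, h1, h2⟩ := exists_add_of_coeff_mul_ne_zero hne
      -- A pair of opposite parity lowers both counts by one and costs at least one factor; a pair
      -- of equal parity lowers one count by two and costs at least two. In either case the maximum
      -- drops by at most the cost.
      have h3 := le_degree_of_coeff_qTwoPoly_ne_zero (hl.lt_head (mem_of_cons_perm hp)) h1
      have h4 := ih r.length (by have := hp.length_eq; simp at this ⊢; omega)
        (hl.remove hp hs) h2 rfl
      rw [minLength] at h4 ⊢
      rw [oddCount_of_perm hp, evenCount_of_perm hp, map_add]
      omega

/-- In a term of least length of `Q_l`, the two factors of a term of the recurrence have their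
least lengths. -/
theorem degree_eq_of_add {x y : ℕ} {t r : List ℕ} (hl : IsPadded (x :: t))
    (hp : (y :: r).Perm t) (hs : r.Sublist t) {m₁ m₂ : ℕ+ →₀ ℕ}
    (h1 : coeff m₁ (qTwoPoly x y) ≠ 0) (h2 : coeff m₂ (schurQPoly r) ≠ 0)
    (hm : (m₁ + m₂).degree = minLength (x :: t)) :
    m₁.degree = 2 - (x + y) % 2 ∧ m₂.degree = minLength r := by
  have h3 := le_degree_of_coeff_qTwoPoly_ne_zero (hl.lt_head (mem_of_cons_perm hp)) h1
  have h4 := minLength_le_degree (hl.remove hp hs) h2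
  rw [map_add] at hm
  rw [minLength, oddCount_of_perm hp, evenCount_of_perm hp] at hm
  rw [minLength] at h4 ⊢
  omega

/-- A bound for the indices of the power sums in the terms of least length of `Q_l`. -/
theorem le_add_of_mem_support {l : List ℕ} (hl : IsPadded l) {m : ℕ+ →₀ ℕ}
    (hm : coeff m (schurQPoly l) ≠ 0) (hdeg : m.degree = minLength l) {A B c : ℕ}
    (hA : ∀ a ∈ l, a % 2 = c → a ≤ A) (hB : ∀ a ∈ l, a % 2 ≠ c → a ≤ B) (hc : c < 2)
    {k : ℕ+} (hk : k ∈ m.support) : (k : ℕ) ≤ A + B := by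
  induction hn : l.length using Nat.strong_induction_on generalizing l m with
  | _ n ih =>
    subst hn
    cases l with
    | nil =>
      have : m = 0 := by
        rw [← Finsupp.degree_eq_zero_iff, hdeg]
        rfl
      simp [this] at hk
    | cons x t =>
      rw [coeff_schurQPoly_cons hl] at hm
      obtain ⟨y, r, hp, hs, hne⟩ := exists_of_altSum_ne_zero hm
      obtain ⟨m₁, m₂, rfl, h1, h2⟩ := exists_add_of_coeff_mul_ne_zero hne
      obtain ⟨h3, h4⟩ := degree_eq_of_add hl hp hs h1 h2 hdeg
      have hyt := mem_of_cons_perm hp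
      have hyx := hl.lt_head hyt
      have hrt : ∀ a ∈ r, a ∈ x :: t := fun a ha => List.mem_cons_of_mem _ (hs.subset ha)
      rcases Finset.mem_union.1 (Finsupp.support_add hk) with hk1 | hk2
      · have hw := (weight_eq_of_coeff_qTwoPoly_ne_zero h1).1
        have hkw := le_weight_of_mem_support hk1
        have hxA := hA x (by simp)
        have hxB := hB x (by simp)
        have hyA := hA y (List.mem_cons_of_mem _ hyt)
        have hyB := hB y (List.mem_cons_of_mem _ hyt)
        -- For opposite parities one of `x`, `y` is at most `A` and the other at most `B`, and an
        -- index never exceeds the weight `x + y`. For equal parities the first factor has degree 2,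
        -- so its indices are at most `x`.
        by_cases hpar : (x + y) % 2 = 1
        · by_cases hx : x % 2 = c
          · have := hxA hx
            have := hyB (by omega)
            omega
          · have := hxB hx
            have := hyA (by omega)
            omega
        · have := le_of_coeff_qTwoPoly_ne_zero hyx h1 (by omega) hk1
          by_cases hx : x % 2 = c
          · have := hxA hx
            omega
          · have := hxB hx
            omega
      · exact ih r.length (by have := hp.length_eq; simp at this ⊢; omega) (hl.remove hp hs) h2 h4
          (fun a ha => hA a (hrt a ha)) (fun a ha => hB a (hrt a ha)) hk2 rfl

/-- The product of the `p_a` over the positive entries of a list. -/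
def partMonomial (l : List ℕ) : ℕ+ →₀ ℕ :=
  (l.map fun a => if h : 0 < a then Finsupp.single (a.toPNat h) 1 else 0).sum

/-- The coefficient of `partMonomial l` in the product of the `q_a`, for odd or zero entries. -/
def partCoeff (l : List ℕ) : ℚ := (l.map fun a : ℕ => if a = 0 then 1 else 2 / (a : ℚ)).prod

theorem List.Perm.partMonomial_eq {l l' : List ℕ} (h : l.Perm l') :
    partMonomial l = partMonomial l' := (h.map _).sum_eq

theorem List.Perm.partCoeff_eq {l l' : List ℕ} (h : l.Perm l') : partCoeff l = partCoeff l' :=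
  (h.map _).prod_eq

theorem partCoeff_ne_zero (l : List ℕ) : partCoeff l ≠ 0 := by
  refine List.prod_ne_zero ?_
  intro h
  obtain ⟨a, -, ha⟩ := List.mem_map.1 h
  split_ifs at ha with h0
  · exact one_ne_zero ha
  · have : (a : ℚ) ≠ 0 := by exact_mod_cast h0
    exact div_ne_zero two_ne_zero this ha

theorem degree_partMonomial {l : List ℕ} (hl : ∀ a ∈ l, a = 0 ∨ a % 2 = 1) :
    (partMonomial l).degree = oddCount l := by
  induction l with
  | nil => rfl
  | cons a t ih =>
    have ih' := ih fun b hb => hl b (List.mem_cons_of_mem _ hb)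
    rw [partMonomial] at ih'
    rw [partMonomial, List.map_cons, List.sum_cons, map_add, ih', oddCount_cons, add_comm]
    rcases hl a (by simp) with h | h
    · simp [h]
    · rw [dif_pos (show 0 < a by omega), Finsupp.degree_single, h]

/-- Zero is the only possible even entry and occurs at most once. If it occurs, the even length
leaves at least one odd entry. -/
theorem minLength_of_odd_or_zero {l : List ℕ} (hl : IsPadded l) (h : ∀ a ∈ l, a = 0 ∨ a % 2 = 1) :
    minLength l = oddCount l := by
  have h1 : evenCount l ≤ 1 := by
    have hn : l.Nodup := hl.2.imp fun h => ne_of_gt h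
    have : evenCount l = l.count 0 := by
      rw [evenCount, List.count]
      refine List.countP_congr fun a ha => ?_
      rcases h a ha with h | h
      · simp [h]
      · have : a ≠ 0 := by omega
        simp [h, this]
    rw [this]
    exact List.nodup_iff_count_le_one.1 hn 0
  have h2 := oddCount_add_evenCount l
  have h3 := Nat.even_iff.1 hl.1
  rw [minLength]
  omega

theorem coeff_single_qTwoPoly_zero {a : ℕ} (ha : a % 2 = 1) (ha0 : 0 < a) :
    coeff (Finsupp.single (a.toPNat ha0) 1) (qTwoPoly a 0) = 2 / (a : ℚ) := by
  rw [← linCoeff_eq, linCoeff_qTwoPoly a 0 ha0 (a.toPNat ha0) (by simp) (Nat.odd_iff.2 ha),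
    if_pos rfl]
  simp

theorem coeff_single_add_single_qTwoPoly {a b : ℕ} (hab : b < a) (ha : a % 2 = 1)
    (hb : b % 2 = 1) (ha0 : 0 < a) (hb0 : 0 < b) :
    coeff (Finsupp.single (a.toPNat ha0) 1 + Finsupp.single (b.toPNat hb0) 1) (qTwoPoly a b) =
      -(2 / (a : ℚ) * (2 / b)) := by
  have hq := quadCoeff_qTwoPoly a b hab (b.toPNat hb0) (a.toPNat ha0) (by simp [add_comm])
    (PNat.coe_le_coe _ _ |>.1 hab.le) (Nat.odd_iff.2 hb) (Nat.odd_iff.2 ha)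
  have hne : (b.toPNat hb0) ≠ (a.toPNat ha0) := by
    intro h
    have := congrArg PNat.val h
    simp at this
    omega
  rw [quadCoeff_eq, Finsupp.single_eq_of_ne hne.symm, if_neg (by simp), if_pos (by simp),
    add_comm (Finsupp.single _ 1)] at hq
  simp only [coe_toPNat, zero_add, Nat.cast_one, mul_one] at hq
  rw [hq]
  field_simp
  norm_num

theorem partMonomial_cons_cons {x y : ℕ} {r t : List ℕ} (hp : (y :: r).Perm t) :
    partMonomial (x :: t) = ((if h : 0 < x then Finsupp.single (x.toPNat h) 1 else 0) +
      if h : 0 < y then Finsupp.single (y.toPNat h) 1 else 0) + partMonomial r := by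
  rw [← (hp.cons x).partMonomial_eq]
  simp only [partMonomial, List.map_cons, List.sum_cons]
  rw [add_assoc]

theorem partCoeff_cons_cons {x y : ℕ} {r t : List ℕ} (hp : (y :: r).Perm t) :
    partCoeff (x :: t) = (if x = 0 then 1 else 2 / (x : ℚ)) * (if y = 0 then 1 else 2 / (y : ℚ)) *
      partCoeff r := by
  rw [← (hp.cons x).partCoeff_eq]
  simp only [partCoeff, List.map_cons, List.prod_cons]
  rw [mul_assoc]

/-- A term of least length of `Q_l` if all positive entries of `l` are odd. -/
theorem coeff_partMonomial {l : List ℕ} (hl : IsPadded l) (h : ∀ a ∈ l, a = 0 ∨ a % 2 = 1) :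
    coeff (partMonomial l) (schurQPoly l) =
      (-1) ^ (l.length / 2) * (if 0 ∈ l then -1 else 1) * partCoeff l := by
  induction hn : l.length using Nat.strong_induction_on generalizing l with
  | _ n ih =>
    subst hn
    cases l with
    | nil => simp [schurQPoly_nil, partMonomial, partCoeff]
    | cons x t =>
      -- All terms of the expansion turn out to have the same value, so the claimed value is written
      -- as a constant alternating sum over the tail of odd length.
      rw [coeff_schurQPoly_cons hl, ← altSum_const_of_odd
        ((-1) ^ ((x :: t).length / 2) * (if 0 ∈ x :: t then -1 else 1) * partCoeff (x :: t)) t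
        hl.odd_length_tail]
      refine altSum_congr fun y r hp hs => ?_
      have hyt := mem_of_cons_perm hp
      have hyx := hl.lt_head hyt
      have hr := hl.remove hp hs
      have hrt : ∀ a ∈ r, a ∈ x :: t := fun a ha => List.mem_cons_of_mem _ (hs.subset ha)
      have hlen := hp.length_eq
      rw [List.length_cons] at hlen
      have hx0 : 0 < x := by omega
      have hx : x % 2 = 1 := (h x (by simp)).resolve_left hx0.ne'
      have hy := h y (List.mem_cons_of_mem _ hyt)
      have ih' := ih r.length (by rw [List.length_cons]; omega) hr
        (fun a ha => h a (hrt a ha)) rfl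
      have hyr : y ∉ r := by
        have := hp.nodup_iff.2 hl.nodup_tail
        exact (List.nodup_cons.1 this).1
      have hmin := minLength_of_odd_or_zero hl h
      rw [partMonomial_cons_cons hp, coeff_add_mul_of_unique, ih', partCoeff_cons_cons hp]
      -- A pair of odd entries contributes `-(2/x)(2/y)`, the pair `(x, 0)` contributes `+2/x`.
      -- Hence there is one sign for each pair, corrected once if zero is present.
      · have hlen' : (x :: t).length / 2 = r.length / 2 + 1 := by rw [List.length_cons]; omega
        rw [hlen', pow_succ, dif_pos hx0, if_neg hx0.ne']
        rcases hy with rfl | hy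
        · rw [dif_neg (lt_irrefl 0), add_zero, coeff_single_qTwoPoly_zero hx hx0, if_neg hyr,
            if_pos (List.mem_cons_of_mem _ hyt), if_pos rfl]
          ring
        · have hy0 : 0 < y := by omega
          have hiff : 0 ∈ x :: t ↔ 0 ∈ r := by
            rw [List.mem_cons, ← hp.mem_iff, List.mem_cons]
            constructor
            · rintro (h | h | h)
              · omega
              · omega
              · exact h
            · exact fun h => Or.inr (Or.inr h)
          rw [dif_pos hy0, coeff_single_add_single_qTwoPoly hyx hx hy hx0 hy0, if_neg hy0.ne']
          simp only [hiff]
          ring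
      · intro m₁ m₂ hm h1 h2
        rw [← partMonomial_cons_cons hp] at hm
        have hdeg := degree_partMonomial h
        rw [← hm, ← hmin] at hdeg
        obtain ⟨h3, h4⟩ := degree_eq_of_add hl hp hs h1 h2 hdeg
        have hw := (weight_eq_of_coeff_qTwoPoly_ne_zero h1).1
        have hxm2 : (x.toPNat hx0) ∉ m₂.support := by
          intro hmem
          -- The odd entries of `r` are below `x` and its only possible even entry is zero, so `p_x`
          -- has to come from the first factor; degree and weight then determine that factor.
          have := le_add_of_mem_support hr h2 h4 (A := x - 1) (B := 0) (c := 1)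
            (fun a ha _ => by have := hl.lt_head (hs.subset ha); omega)
            (fun a ha ha' => by
              have := h a (hrt a ha)
              omega) (by norm_num) hmem
          simp only [coe_toPNat] at this
          omega
        have hxm1 : (x.toPNat hx0) ∈ m₁.support := by
          have h5 := DFunLike.congr_fun hm (x.toPNat hx0)
          rw [partMonomial_cons_cons hp, dif_pos hx0, Finsupp.add_apply, Finsupp.add_apply,
            Finsupp.add_apply, Finsupp.single_eq_same, Finsupp.notMem_support_iff.1 hxm2] at h5
          rw [Finsupp.mem_support_iff]
          omega
        rw [dif_pos hx0]
        rcases hy with rfl | hy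
        · rw [dif_neg (lt_irrefl 0), add_zero]
          obtain ⟨k, rfl⟩ := exists_single_of_degree_eq_one (m := m₁) (by omega)
          have : (x.toPNat hx0) = k := by simpa using hxm1
          rw [this]
        · rw [dif_pos (show 0 < y by omega)]
          obtain ⟨j, rfl⟩ := exists_single_add_single_of_degree_eq_two (m := m₁) (by omega) hxm1
          rw [map_add, weight_single_one, weight_single_one] at hw
          congr 2
          refine PNat.eq ?_
          simp only [coe_toPNat] at hw ⊢
          omega

end

/-! ### Monomials of least length that do not cancel -/

noncomputable section

open Finset MvPolynomial

theorem coeff_single_qTwoPoly_ne_zero {a b : ℕ} (ha : 0 < a) (hodd : (a + b) % 2 = 1)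
    (hab : 0 < a + b) : coeff (Finsupp.single ((a + b).toPNat hab) 1) (qTwoPoly a b) ≠ 0 := by
  rw [← linCoeff_eq, linCoeff_qTwoPoly a b ha ((a + b).toPNat hab) rfl (Nat.odd_iff.2 hodd)]
  have h : (((a + b).toPNat hab : ℕ) : ℚ) ≠ 0 := by
    rw [coe_toPNat]
    exact_mod_cast hab.ne'
  refine div_ne_zero ?_ h
  split_ifs
  · norm_num
  · exact mul_ne_zero (by norm_num) (pow_ne_zero _ (by norm_num))

theorem coeff_single_add_single_qTwoPoly_ne_zero {a b : ℕ} (hab : b < a) (ha : a % 2 = 0)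
    (hb : b % 2 = 0) (ha0 : 0 < a - 1) :
    coeff (Finsupp.single ((a - 1).toPNat ha0) 1 + Finsupp.single b.succPNat 1)
      (qTwoPoly a b) ≠ 0 := by
  have hq := quadCoeff_qTwoPoly a b hab b.succPNat ((a - 1).toPNat ha0)
    (by rw [Nat.succPNat_coe, coe_toPNat]; omega)
    ((PNat.coe_le_coe _ _).1 (by rw [Nat.succPNat_coe, coe_toPNat]; omega))
    (by rw [Nat.succPNat_coe, Nat.odd_iff]; omega) (by rw [coe_toPNat, Nat.odd_iff]; omega)
  intro h
  rw [quadCoeff_eq, add_comm (Finsupp.single b.succPNat 1), h, zero_mul, coe_toPNat,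
    if_neg (by omega), if_neg (by omega)] at hq
  have h1 : (((a - 1 : ℕ) : ℚ)) ≠ 0 := by exact_mod_cast ha0.ne'
  have h2 : ((b.succPNat : ℕ) : ℚ) ≠ 0 := by
    rw [Nat.succPNat_coe]
    exact_mod_cast Nat.succ_ne_zero b
  refine absurd hq.symm (mul_ne_zero (div_ne_zero (by norm_num) (mul_ne_zero h2 h1)) ?_)
  split_ifs
  · exact one_ne_zero
  · exact mul_ne_zero two_ne_zero (pow_ne_zero _ (by norm_num))

theorem IsPadded.eq_of_perm {x c : ℕ} {t r r' : List ℕ} (h : IsPadded (x :: t))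
    (hp : (c :: r).Perm t) (hs : r.Sublist t) (hp' : (c :: r').Perm t) (hs' : r'.Sublist t) :
    r = r' :=
  List.Perm.eq_of_pairwise (fun _ _ _ _ h1 h2 => absurd h1 (lt_asymm h2)) (h.remove hp hs).2
    (h.remove hp' hs').2 ((hp.trans hp'.symm).cons_inv)

/-- The term of `Q_l` that belongs to the first entry and the largest entry of the other parity. -/
theorem coeff_ne_zero_of_opposite_parity {x c : ℕ} {t r : List ℕ} (hl : IsPadded (x :: t))
    (hp : (c :: r).Perm t) (hs : r.Sublist t) (hc0 : 0 < c) (hcx : (x + c) % 2 = 1)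
    (hmax : ∀ a ∈ t, (x + a) % 2 = 1 → a ≤ c) {μ : ℕ+ →₀ ℕ} (hμ : coeff μ (schurQPoly r) ≠ 0)
    (hdeg : μ.degree = minLength r) (hN : 0 < x + c) :
    (Finsupp.single ((x + c).toPNat hN) 1 + μ).degree = minLength (x :: t) ∧
      coeff (Finsupp.single ((x + c).toPNat hN) 1 + μ) (schurQPoly (x :: t)) ≠ 0 := by
  have hct := mem_of_cons_perm hp
  have hcx' := hl.lt_head hct
  have hd : (Finsupp.single ((x + c).toPNat hN) 1 + μ).degree = minLength (x :: t) := by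
    rw [map_add, Finsupp.degree_single, hdeg, minLength, minLength, oddCount_of_perm hp,
      evenCount_of_perm hp]
    omega
  refine ⟨hd, ?_⟩
  -- the index `x + c` can only come from the first factor, and only if `y = c`
  have key : ∀ y s, (y :: s).Perm t → s.Sublist t → ∀ m₁ m₂ : ℕ+ →₀ ℕ,
      m₁ + m₂ = Finsupp.single ((x + c).toPNat hN) 1 + μ → coeff m₁ (qTwoPoly x y) ≠ 0 →
      coeff m₂ (schurQPoly s) ≠ 0 → y = c ∧ m₁ = Finsupp.single ((x + c).toPNat hN) 1 := by
    intro y s hps hss m₁ m₂ hm h1 h2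
    rw [← hm] at hd
    obtain ⟨h3, h4⟩ := degree_eq_of_add hl hps hss h1 h2 hd
    have hyt := mem_of_cons_perm hps
    have hyx := hl.lt_head hyt
    have hw := (weight_eq_of_coeff_qTwoPoly_ne_zero h1).1
    have hN2 : ((x + c).toPNat hN) ∉ m₂.support := by
      intro hmem
      have := le_add_of_mem_support (hl.remove hps hss) h2 h4 (A := x - 1) (B := c) (c := x % 2)
        (fun a ha _ => by have := hl.lt_head (hss.subset ha); omega)
        (fun a ha ha' => hmax a (hss.subset ha) (by omega)) (Nat.mod_lt _ two_pos) hmem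
      rw [coe_toPNat] at this
      omega
    have hN1 : ((x + c).toPNat hN) ∈ m₁.support := by
      have h5 := DFunLike.congr_fun hm ((x + c).toPNat hN)
      rw [Finsupp.add_apply, Finsupp.add_apply, Finsupp.single_eq_same,
        Finsupp.notMem_support_iff.1 hN2] at h5
      rw [Finsupp.mem_support_iff]
      omega
    have hle := le_weight_of_mem_support hN1
    rw [hw, coe_toPNat] at hle
    by_cases hpar : (x + y) % 2 = 1
    · have := hmax y hyt hpar
      refine ⟨by omega, ?_⟩
      obtain ⟨k, rfl⟩ := exists_single_of_degree_eq_one (m := m₁) (by omega)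
      have : (x + c).toPNat hN = k := by simpa using hN1
      rw [this]
    -- A pair of equal parity produces only indices up to `x`, which `0 < c` excludes here.
    · have := le_of_coeff_qTwoPoly_ne_zero hyx h1 (by omega) hN1
      rw [coe_toPNat] at this
      omega
  rw [coeff_schurQPoly_cons hl]
  refine altSum_ne_zero_of_unique hl.nodup_tail hct ?_ ?_
  · intro y s hps hss hyc
    by_contra hne
    obtain ⟨m₁, m₂, hm, h1, h2⟩ := exists_add_of_coeff_mul_ne_zero hne
    exact hyc (key y s hps hss m₁ m₂ hm h1 h2).1
  · intro s hps hss
    obtain rfl := hl.eq_of_perm hps hss hp hs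
    rw [coeff_add_mul_of_unique fun m₁ m₂ hm h1 h2 => (key c s hps hss m₁ m₂ hm h1 h2).2]
    exact mul_ne_zero (coeff_single_qTwoPoly_ne_zero (by omega) hcx hN) hμ

/-- The term of `Q_l` that belongs to the first two entries if all entries are even. -/
theorem coeff_ne_zero_of_even {x c : ℕ} {r : List ℕ} (hl : IsPadded (x :: c :: r))
    (heven : ∀ a ∈ x :: c :: r, a % 2 = 0) {μ : ℕ+ →₀ ℕ} (hμ : coeff μ (schurQPoly r) ≠ 0)
    (hdeg : μ.degree = minLength r) (hx : 0 < x - 1) :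
    ((Finsupp.single ((x - 1).toPNat hx) 1 + Finsupp.single c.succPNat 1) + μ).degree =
        minLength (x :: c :: r) ∧
      coeff ((Finsupp.single ((x - 1).toPNat hx) 1 + Finsupp.single c.succPNat 1) + μ)
        (schurQPoly (x :: c :: r)) ≠ 0 := by
  have hx2 := heven x (by simp)
  have hc2 := heven c (by simp)
  have hcx := hl.lt_head (z := c) (by simp)
  have hc : ∀ a ∈ c :: r, a ≤ c := fun a ha => by
    rcases List.mem_cons.1 ha with rfl | ha
    · exact le_rfl
    · exact ((List.pairwise_cons.1 (List.pairwise_cons.1 hl.2).2).1 a ha).le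
  have hmin : minLength (x :: c :: r) = minLength r + 2 := by
    have : oddCount r = 0 := by
      rw [oddCount, List.countP_eq_zero]
      intro a ha
      have := heven a (by simp [ha])
      simp [this]
    rw [minLength, minLength, oddCount_of_perm (List.Perm.refl _),
      evenCount_of_perm (List.Perm.refl _)]
    omega
  set a₁ := (x - 1).toPNat hx with ha₁
  set a₂ := c.succPNat with ha₂
  have ha₁' : (a₁ : ℕ) = x - 1 := rfl
  have ha₂' : (a₂ : ℕ) = c + 1 := rfl
  have hd : ((Finsupp.single a₁ 1 + Finsupp.single a₂ 1) + μ).degree =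
      minLength (x :: c :: r) := by
    rw [map_add, map_add, Finsupp.degree_single, Finsupp.degree_single, hdeg, hmin]
    omega
  refine ⟨hd, ?_⟩
  have key : ∀ y s, (y :: s).Perm (c :: r) → s.Sublist (c :: r) → ∀ m₁ m₂ : ℕ+ →₀ ℕ,
      m₁ + m₂ = (Finsupp.single a₁ 1 + Finsupp.single a₂ 1) + μ →
      coeff m₁ (qTwoPoly x y) ≠ 0 → coeff m₂ (schurQPoly s) ≠ 0 →
      y = c ∧ m₁ = Finsupp.single a₁ 1 + Finsupp.single a₂ 1 := by
    intro y s hps hss m₁ m₂ hm h1 h2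
    rw [← hm] at hd
    obtain ⟨h3, h4⟩ := degree_eq_of_add hl hps hss h1 h2 hd
    have hyt := mem_of_cons_perm hps
    have hy2 := heven y (List.mem_cons_of_mem _ hyt)
    have hw := (weight_eq_of_coeff_qTwoPoly_ne_zero h1).1
    -- All entries of `s` are even and at most `c`, so terms of least length of its `Q`-function
    -- have no index beyond `c`.
    have hbig : ∀ k : ℕ+, c < k → m₂ k = 0 := by
      intro k hk
      by_contra hne
      have := le_add_of_mem_support (hl.remove hps hss) h2 h4 (A := c) (B := 0) (c := 0)
        (fun a ha _ => hc a (hss.subset ha))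
        (fun a ha ha' => absurd (heven a (List.mem_cons_of_mem _ (hss.subset ha))) ha')
        two_pos (Finsupp.mem_support_iff.2 hne)
      omega
    -- Both `x - 1` and `c + 1` exceed `c`. They coincide if `x = c + 2`, so the comparison is one
    -- of exponents. As `m₁` has degree 2, it equals this monomial, and its weight `x + c` gives `y
    -- = c`.
    have hle : Finsupp.single a₁ 1 + Finsupp.single a₂ 1 ≤ m₁ := by
      intro k
      have h5 := DFunLike.congr_fun hm k
      rw [Finsupp.add_apply, Finsupp.add_apply] at h5
      by_cases hk : c < k
      · rw [hbig k hk] at h5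
        omega
      · have hk1 : k ≠ a₁ := by rintro rfl; omega
        have hk2 : k ≠ a₂ := by rintro rfl; omega
        rw [Finsupp.add_apply, Finsupp.single_eq_of_ne hk1, Finsupp.single_eq_of_ne hk2]
        exact Nat.zero_le _
    have hsplit := add_tsub_cancel_of_le hle
    have hz : m₁ - (Finsupp.single a₁ 1 + Finsupp.single a₂ 1) = 0 := by
      rw [← Finsupp.degree_eq_zero_iff]
      have := congrArg Finsupp.degree hsplit
      rw [map_add, map_add, Finsupp.degree_single, Finsupp.degree_single] at this
      omega
    rw [hz, add_zero] at hsplit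
    refine ⟨?_, hsplit.symm⟩
    rw [← hsplit, map_add, weight_single_one, weight_single_one] at hw
    omega
  rw [coeff_schurQPoly_cons hl]
  refine altSum_ne_zero_of_unique hl.nodup_tail (c := c) (by simp) ?_ ?_
  · intro y s hps hss hyc
    by_contra hne
    obtain ⟨m₁, m₂, hm, h1, h2⟩ := exists_add_of_coeff_mul_ne_zero hne
    exact hyc (key y s hps hss m₁ m₂ hm h1 h2).1
  · intro s hps hss
    obtain rfl := hl.eq_of_perm hps hss (List.Perm.refl _) (List.sublist_cons_self _ _)
    rw [coeff_add_mul_of_unique fun m₁ m₂ hm h1 h2 => (key c s hps hss m₁ m₂ hm h1 h2).2]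
    exact mul_ne_zero (coeff_single_add_single_qTwoPoly_ne_zero hcx hx2 hc2 hx) hμ

/-- The bound `minLength_le_degree` is attained. -/
theorem exists_degree_eq_minLength {l : List ℕ} (hl : IsPadded l) :
    ∃ m : ℕ+ →₀ ℕ, m.degree = minLength l ∧ coeff m (schurQPoly l) ≠ 0 := by
  induction hn : l.length using Nat.strong_induction_on generalizing l with
  | _ n ih =>
    subst hn
    cases l with
    | nil => exact ⟨0, rfl, by simp [schurQPoly_nil]⟩
    | cons x t =>
      have hlt : ∀ y r, (y :: r).Perm t → r.length < (x :: t).length := fun y r hp => by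
        have := hp.length_eq
        rw [List.length_cons] at this ⊢
        omega
      by_cases hopp : ∃ c ∈ t, 0 < c ∧ (x + c) % 2 = 1
      -- Zero is not admitted as partner: the index `x + 0` could also come from a pair of equal
      -- parity.
      · let S := t.toFinset.filter fun c => 0 < c ∧ (x + c) % 2 = 1
        have hS : S.Nonempty := by
          obtain ⟨c, hc⟩ := hopp
          exact ⟨c, by simpa [S] using hc⟩
        have hmem := S.max'_mem hS
        set c := S.max' hS with hcdef
        simp only [S, mem_filter, List.mem_toFinset] at hmem
        have hp : (c :: t.erase c).Perm t := (List.perm_cons_erase hmem.1).symm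
        have hs : (t.erase c).Sublist t := List.erase_sublist
        obtain ⟨μ, hdeg, hμ⟩ := ih _ (hlt _ _ hp) (hl.remove hp hs) rfl
        refine ⟨_, coeff_ne_zero_of_opposite_parity hl hp hs hmem.2.1 hmem.2.2 ?_ hμ hdeg
          (by omega)⟩
        intro a ha hpar
        rcases Nat.eq_zero_or_pos a with rfl | h0
        · exact Nat.zero_le _
        · exact S.le_max' a (by simp [S, ha, hpar, h0])
      · push Not at hopp
        by_cases hx : x % 2 = 1
        · have hodd : ∀ a ∈ x :: t, a = 0 ∨ a % 2 = 1 := by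
            intro a ha
            rcases List.mem_cons.1 ha with rfl | ha
            · exact Or.inr hx
            · rcases Nat.eq_zero_or_pos a with h0 | h0
              · exact Or.inl h0
              · have := hopp a ha h0
                omega
          refine ⟨partMonomial (x :: t), ?_, ?_⟩
          · rw [degree_partMonomial hodd, minLength_of_odd_or_zero hl hodd]
          · rw [coeff_partMonomial hl hodd]
            refine mul_ne_zero (mul_ne_zero (pow_ne_zero _ (by norm_num)) ?_) (partCoeff_ne_zero _)
            split_ifs <;> norm_num
        · cases t with
          | nil => exact absurd hl.1 (by simp)
          | cons c r =>
            have heven : ∀ a ∈ x :: c :: r, a % 2 = 0 := by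
              intro a ha
              rcases List.mem_cons.1 ha with rfl | ha
              · omega
              · rcases Nat.eq_zero_or_pos a with h0 | h0
                · rw [h0]
                · have := hopp a ha h0
                  omega
            have hcx := hl.lt_head (z := c) (by simp)
            obtain ⟨μ, hdeg, hμ⟩ := ih _ (hlt c r (List.Perm.refl _))
              (hl.remove (List.Perm.refl _) (List.sublist_cons_self _ _)) rfl
            exact ⟨_, coeff_ne_zero_of_even hl heven hμ hdeg (by omega)⟩

/-- The least length of a term of `Q_lam`. -/
theorem isLeast_degree_schurQPoly {lam : List ℕ} (hstrict : lam.Pairwise (· > ·))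
    (hpos : ∀ a ∈ lam, 0 < a) : IsLeast {d | ∃ m ∈ (schurQPoly lam).support, m.degree = d}
      (max (oddCount lam) (evenCount lam + lam.length % 2)) := by
  have h : ∀ l, IsPadded l →
      IsLeast {d | ∃ m ∈ (schurQPoly l).support, m.degree = d} (minLength l) := by
    intro l hl
    constructor
    · obtain ⟨m, h1, h2⟩ := exists_degree_eq_minLength hl
      exact ⟨m, mem_support_iff.2 h2, h1⟩
    · rintro d ⟨m, hm, rfl⟩
      exact minLength_le_degree hl (mem_support_iff.1 hm)
  rcases Nat.even_or_odd lam.length with he | ho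
  · rw [Nat.even_iff.1 he, add_zero]
    exact h lam ⟨he, hstrict⟩
  -- The appended zero counts as an even entry, whence the summand `lam.length % 2`.
  · rw [← schurQPoly_append_zero lam ho, Nat.odd_iff.1 ho]
    have hperm : (lam ++ [0]).Perm (0 :: lam) := List.perm_append_singleton 0 lam
    have := h (lam ++ [0]) ⟨by simpa using ho.add_one, by
      rw [List.pairwise_append]
      refine ⟨hstrict, by simp, fun a ha b hb => ?_⟩
      rw [List.mem_singleton.1 hb]
      exact hpos a ha⟩
    rwa [minLength, hperm.oddCount_eq, hperm.evenCount_eq, oddCount_cons, evenCount_cons] at this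

/-- The power sum expansion of `Q_lam` exists and is unique. -/
theorem isPowerSumExpansion_schurQ_iff (lam : List ℕ) (F : MvPolynomial ℕ+ ℚ) :
    IsPowerSumExpansion F (schurQ lam) ↔ F = schurQPoly lam := by
  rw [IsPowerSumExpansion, ← aeval_schurQPoly]
  exact aeval_powerSum_injective.eq_iff

end

/-! ### Lower bound for the number of bars -/

noncomputable section

open Finset

section Rows

variable (lam : List ℕ)

theorem oddCount_take_succ {i : ℕ} (hi : i < lam.length) :
    oddCount (lam.take (i + 1)) = oddCount (lam.take i) + lam.getD i 0 % 2 := by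
  rw [List.take_add_one, List.getElem?_eq_getElem hi, Option.toList_some,
    (List.perm_append_singleton _ _).oddCount_eq, oddCount_cons, List.getD_eq_getElem _ _ hi]

theorem evenCount_take_succ {i : ℕ} (hi : i < lam.length) :
    evenCount (lam.take (i + 1)) = evenCount (lam.take i) + (1 - lam.getD i 0 % 2) := by
  rw [List.take_add_one, List.getElem?_eq_getElem hi, Option.toList_some,
    (List.perm_append_singleton _ _).evenCount_eq, evenCount_cons, List.getD_eq_getElem _ _ hi]

/-- The rows of odd length. -/
def oddRows : Finset ℕ := (range lam.length).filter fun i => lam.getD i 0 % 2 = 1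

/-- The rows of even length. -/
def evenRows : Finset ℕ := (range lam.length).filter fun i => lam.getD i 0 % 2 = 0

theorem mem_oddRows (i : ℕ) : i ∈ oddRows lam ↔ i < lam.length ∧ lam.getD i 0 % 2 = 1 := by
  rw [oddRows, mem_filter, mem_range]

theorem mem_evenRows (i : ℕ) : i ∈ evenRows lam ↔ i < lam.length ∧ lam.getD i 0 % 2 = 0 := by
  rw [evenRows, mem_filter, mem_range]

theorem card_rows_take (n : ℕ) (hn : n ≤ lam.length) :
    ((range n).filter fun i => lam.getD i 0 % 2 = 1).card = oddCount (lam.take n) ∧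
    ((range n).filter fun i => lam.getD i 0 % 2 = 0).card = evenCount (lam.take n) := by
  induction n with
  | zero => simp [oddCount, evenCount]
  | succ n ih =>
    obtain ⟨h1, h2⟩ := ih (by omega)
    rw [oddCount_take_succ lam (by omega), evenCount_take_succ lam (by omega), range_add_one,
      filter_insert, filter_insert]
    rcases Nat.mod_two_eq_zero_or_one (lam.getD n 0) with h | h
    · rw [if_neg (by omega), if_pos h, card_insert_of_notMem (by simp), h1, h2, h]
      exact ⟨rfl, rfl⟩
    · rw [if_pos h, if_neg (by omega), card_insert_of_notMem (by simp), h1, h2, h]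
      exact ⟨rfl, rfl⟩

theorem card_oddRows : (oddRows lam).card = oddCount lam := by
  rw [oddRows, (card_rows_take lam _ le_rfl).1, List.take_length]

theorem card_evenRows : (evenRows lam).card = evenCount lam := by
  rw [evenRows, (card_rows_take lam _ le_rfl).2, List.take_length]

/-- The squares of a row. -/
theorem card_filter_row (p : ℕ × ℕ → Prop) [DecidablePred p] (i : ℕ) :
    ((shiftedDiagram lam).filter fun c => c.1 = i ∧ p c).card =
      ((Ico i (i + lam.getD i 0)).filter fun j => p (i, j)).card := by
  conv_rhs => rw [← card_image_of_injective _ (Prod.mk_right_injective i)]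
  congr 1
  ext ⟨i', j⟩
  simp only [mem_filter, mem_shiftedDiagram, mem_image, mem_Ico, Prod.mk.injEq]
  constructor
  · rintro ⟨⟨h, h1, h2⟩, rfl, hp⟩
    exact ⟨j, ⟨⟨h1, by rwa [List.getD_eq_getElem _ _ h]⟩, hp⟩, rfl, rfl⟩
  · rintro ⟨j', ⟨⟨h1, h2⟩, hp⟩, rfl, rfl⟩
    have h : i < lam.length := by
      by_contra hc
      rw [List.getD_eq_default _ _ (by omega)] at h2
      omega
    rw [List.getD_eq_getElem _ _ h] at h2
    exact ⟨⟨h, h1, h2⟩, rfl, hp⟩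

theorem card_row (i : ℕ) :
    ((shiftedDiagram lam).filter fun c => c.1 = i).card = lam.getD i 0 := by
  have := card_filter_row lam (fun _ => True) i
  simpa using this

theorem mem_shiftedDiagram_diag (hpos : ∀ a ∈ lam, 0 < a) {i : ℕ} (hi : i < lam.length) :
    (i, i) ∈ shiftedDiagram lam := by
  rw [mem_shiftedDiagram]
  have := hpos _ (List.getElem_mem hi)
  exact ⟨hi, le_rfl, by omega⟩

theorem fst_lt_of_mem {c : ℕ × ℕ} (hc : c ∈ shiftedDiagram lam) : c.1 < lam.length := by
  obtain ⟨h, -⟩ := (mem_shiftedDiagram lam c.1 c.2).1 hc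
  exact h

end Rows

namespace BarTableau

variable {lam : List ℕ} (T : BarTableau lam)

/-- The number of squares of the row `i` with the entry `k`. -/
def rowCount (i k : ℕ) : ℕ := ((shiftedDiagram lam).filter fun c => c.1 = i ∧ T.entry c = k).card

/-- The entries that occur. -/
def values : Finset ℕ := (shiftedDiagram lam).image T.entry

theorem pos_of_mem_values {k : ℕ} (hk : k ∈ T.values) : 0 < k := by
  obtain ⟨c, hc, rfl⟩ := mem_image.1 hk
  exact T.entry_pos c hc

theorem sum_rowCount_values (i : ℕ) : ∑ k ∈ T.values, T.rowCount i k = lam.getD i 0 := by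
  rw [← card_row lam i, card_eq_sum_card_fiberwise (f := T.entry) (t := T.values)
    (fun c hc => mem_image_of_mem _ (mem_filter.1 hc).1)]
  simp only [rowCount, filter_filter]

theorem sum_rowCount_rows (k : ℕ) : ∑ i ∈ range lam.length, T.rowCount i k =
    ((shiftedDiagram lam).filter fun c => T.entry c = k).card := by
  rw [card_eq_sum_card_fiberwise (f := Prod.fst) (t := range lam.length)
    (fun c hc => mem_coe.2 (mem_range.2 (fst_lt_of_mem lam (mem_filter.1 hc).1)))]
  simp only [rowCount, filter_filter]
  exact sum_congr rfl fun i _ => by simp only [and_comm]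

theorem exists_of_rowCount_ne_zero {i k : ℕ} (h : T.rowCount i k ≠ 0) :
    ∃ c ∈ shiftedDiagram lam, c.1 = i ∧ T.entry c = k := by
  obtain ⟨c, hc⟩ := card_ne_zero.1 h
  exact ⟨c, by simpa using hc⟩

theorem mem_rows_of_rowCount_ne_zero {i k : ℕ} (h : T.rowCount i k ≠ 0) :
    i ∈ ((shiftedDiagram lam).filter fun c => T.entry c = k).image Prod.fst := by
  obtain ⟨c, hc, rfl, hk⟩ := T.exists_of_rowCount_ne_zero h
  exact mem_image_of_mem _ (mem_filter.2 ⟨hc, hk⟩)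

/-- Every bar has an odd number of squares in exactly one row. -/
theorem card_odd_rowCount {k : ℕ} (hk : k ∈ T.values) :
    ((range lam.length).filter fun i => Odd (T.rowCount i k)).card = 1 := by
  have hk0 := T.pos_of_mem_values hk
  obtain ⟨c, hc, rfl⟩ := mem_image.1 hk
  have hodd := T.odd_count c hc
  -- The bar has odd size, so the number of rows in which it is odd is itself odd; it is at most 2.
  rw [← T.sum_rowCount_rows, odd_sum_iff_odd_card_odd] at hodd
  have hle : ((range lam.length).filter fun i => Odd (T.rowCount i (T.entry c))).card ≤ 2 := by
    refine (card_le_card fun i hi => ?_).trans (T.rows_le_two _ hk0)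
    exact T.mem_rows_of_rowCount_ne_zero (mem_filter.1 hi).2.pos.ne'
  obtain ⟨r, hr⟩ := hodd
  omega

/-- The number of bars with an odd number of squares in the row `i`. -/
def oddBars (i : ℕ) : ℕ := (T.values.filter fun k => Odd (T.rowCount i k)).card

/-- Each bar is charged to the one row in which it has an odd number of squares; that row is said to
own the bar. -/
theorem sum_oddBars : ∑ i ∈ range lam.length, T.oddBars i = T.numBars := by
  have h := sum_card_bipartiteAbove_eq_sum_card_bipartiteBelow (s := range lam.length)
    (t := T.values) (fun i k => Odd (T.rowCount i k))
  simp only [bipartiteAbove, bipartiteBelow] at h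
  rw [sum_congr rfl fun k hk => T.card_odd_rowCount hk, sum_const, smul_eq_mul, mul_one] at h
  exact h

theorem oddBars_mod_two (i : ℕ) : T.oddBars i % 2 = lam.getD i 0 % 2 := by
  have h := odd_sum_iff_odd_card_odd (s := T.values) (T.rowCount i)
  rw [sum_rowCount_values, Nat.odd_iff, Nat.odd_iff] at h
  change _ ↔ T.oddBars i % 2 = 1 at h
  omega

/-- An odd row owns an odd number of bars, hence at least one. -/
theorem oddCount_le_numBars : oddCount lam ≤ T.numBars := by
  rw [← sum_oddBars, ← card_oddRows, card_eq_sum_ones]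
  refine (sum_le_sum fun i hi => ?_).trans
    (sum_le_sum_of_subset (f := T.oddBars) (filter_subset _ (range lam.length)))
  have := ((mem_oddRows lam i).1 hi).2
  have := T.oddBars_mod_two i
  omega

/-- This parity supplies the additional bar when the number of rows is odd: then `evenCount` has the
wrong parity to be the number of bars. -/
theorem numBars_mod_two : T.numBars % 2 = oddCount lam % 2 := by
  have h : oddCount lam = ∑ i ∈ range lam.length, lam.getD i 0 % 2 := by
    rw [← card_oddRows, oddRows, card_filter]
    refine sum_congr rfl fun i _ => ?_
    split_ifs with h
    · exact h.symm
    · omega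
  rw [h, ← sum_nat_mod, ← sum_oddBars, sum_nat_mod, sum_nat_mod (f := fun i => lam.getD i 0)]
  simp only [oddBars_mod_two]

/-- For a row without bars of its own, the row that shares its first bar. -/
theorem exists_row_of_oddBars_eq_zero (hpos : ∀ a ∈ lam, 0 < a) {i : ℕ} (hi : i < lam.length)
    (h0 : T.oddBars i = 0) : ∃ j, j < lam.length ∧ j ≠ i ∧ T.oddBars j ≠ 0 ∧
      T.entry (j, j) = T.entry (i, i) ∧ (j, j) ∈ shiftedDiagram lam := by
  have hmem := mem_shiftedDiagram_diag lam hpos hi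
  have hk : T.entry (i, i) ∈ T.values := mem_image_of_mem _ hmem
  obtain ⟨j, hj⟩ := card_eq_one.1 (T.card_odd_rowCount hk)
  have hj' : j ∈ (range lam.length).filter fun i' => Odd (T.rowCount i' (T.entry (i, i))) := by
    rw [hj]; exact mem_singleton_self j
  rw [mem_filter, mem_range] at hj'
  have hbar : T.oddBars j ≠ 0 := card_ne_zero.2 ⟨_, mem_filter.2 ⟨hk, hj'.2⟩⟩
  have hne : j ≠ i := by
    rintro rfl
    exact hbar h0
  obtain ⟨c, hc, rfl, hck⟩ := T.exists_of_rowCount_ne_zero hj'.2.pos.ne'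
  refine ⟨c.1, hj'.1, hne, hbar, ?_, mem_shiftedDiagram_diag lam hpos hj'.1⟩
  exact (T.begin_of_two_rows _ (T.pos_of_mem_values hk) c hc (i, i) hmem hck rfl hne).1

/-- Even rows without bars of their own (`A`) are sent by `g` to the row that owns their first bar.
The other even rows (`B`) own at least two bars each, so they can pay for themselves and for one
partner; an odd row owns at least one bar and pays for a partner only. -/
theorem evenCount_le_numBars (hpos : ∀ a ∈ lam, 0 < a) : evenCount lam ≤ T.numBars := by
  have hex : ∀ i, ∃ j, i < lam.length → T.oddBars i = 0 → j < lam.length ∧ j ≠ i ∧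
      T.oddBars j ≠ 0 ∧ T.entry (j, j) = T.entry (i, i) ∧ (j, j) ∈ shiftedDiagram lam := by
    intro i
    by_cases h : i < lam.length ∧ T.oddBars i = 0
    · obtain ⟨j, hj⟩ := T.exists_row_of_oddBars_eq_zero hpos h.1 h.2
      exact ⟨j, fun _ _ => hj⟩
    · exact ⟨0, fun h1 h2 => absurd ⟨h1, h2⟩ h⟩
  choose g hg using hex
  let A := (evenRows lam).filter fun i => T.oddBars i = 0
  let B := (evenRows lam).filter fun i => ¬ T.oddBars i = 0
  have hA : ∀ i ∈ A, i < lam.length ∧ T.oddBars i = 0 := fun i hi => by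
    simp only [A, mem_filter, mem_evenRows] at hi
    exact ⟨hi.1.1, hi.2⟩
  have hinj : Set.InjOn g A := by
    intro i hi i' hi' heq
    obtain ⟨hi1, hi2⟩ := hA i hi
    obtain ⟨hi1', hi2'⟩ := hA i' hi'
    obtain ⟨hj1, hj2, -, hj3, hj4⟩ := hg i hi1 hi2
    obtain ⟨-, hj2', -, hj3', -⟩ := hg i' hi1' hi2'
    rw [← heq] at hj2' hj3'
    by_contra hne
    have hd := mem_shiftedDiagram_diag lam hpos hi1
    have hd' := mem_shiftedDiagram_diag lam hpos hi1'
    have h2 := T.rows_le_two _ (T.entry_pos _ hd)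
    -- If two rows of `A` had the same owner, all three rows would begin with the same entry, which
    -- may occur in at most two rows.
    have hsub : ({i, i', g i} : Finset ℕ) ⊆ ((shiftedDiagram lam).filter fun c =>
        T.entry c = T.entry (i, i)).image Prod.fst := by
      intro j hj
      rw [mem_insert, mem_insert, mem_singleton] at hj
      refine mem_image.2 ⟨(j, j), mem_filter.2 ?_, rfl⟩
      rcases hj with rfl | rfl | rfl
      · exact ⟨hd, rfl⟩
      · exact ⟨hd', hj3'.symm.trans hj3⟩
      · exact ⟨hj4, hj3⟩
    have h3 := (card_le_card hsub).trans h2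
    rw [card_insert_of_notMem, card_insert_of_notMem, card_singleton] at h3
    · omega
    · rw [mem_singleton]
      exact hj2'.symm
    · rw [mem_insert, mem_singleton]
      rintro (h | h)
      · exact hne h
      · exact hj2 h.symm
  have hAB : evenCount lam = (A.image g).card + B.card := by
    rw [card_image_of_injOn hinj, ← card_evenRows]
    exact (card_filter_add_card_filter_not _).symm
  have hcard : ∀ S ⊆ range lam.length,
      S.card = ∑ i ∈ range lam.length, if i ∈ S then 1 else 0 := by
    intro S hS
    rw [← card_filter]
    congr 1
    ext i
    rw [mem_filter]
    exact ⟨fun h => ⟨hS h, h⟩, fun h => h.2⟩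
  rw [hAB, hcard (A.image g), hcard B, ← sum_add_distrib, ← sum_oddBars]
  · refine sum_le_sum fun i _ => ?_
    have hmod := T.oddBars_mod_two i
    have h1 : i ∈ A.image g → T.oddBars i ≠ 0 := by
      intro h
      obtain ⟨j, hj, rfl⟩ := mem_image.1 h
      exact (hg j (hA j hj).1 (hA j hj).2).2.2.1
    have h2 : i ∈ B → T.oddBars i ≠ 0 ∧ lam.getD i 0 % 2 = 0 := by
      intro h
      simp only [B, mem_filter, mem_evenRows] at h
      exact ⟨h.2, h.1.2⟩
    split_ifs with h3 h4 h4
    · have := h2 h4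
      omega
    · have := h1 h3
      omega
    · have := h2 h4
      omega
    · omega
  · intro i hi
    simp only [B, mem_filter, mem_evenRows] at hi
    exact mem_range.2 hi.1.1
  · intro i hi
    obtain ⟨j, hj, rfl⟩ := mem_image.1 hi
    exact mem_range.2 (hg j (hA j hj).1 (hA j hj).2).1

/-- The lower bound for the number of bars. -/
theorem max_le_numBars (hpos : ∀ a ∈ lam, 0 < a) :
    max (oddCount lam) (evenCount lam + lam.length % 2) ≤ T.numBars := by
  have h1 := T.oddCount_le_numBars
  have h2 := T.evenCount_le_numBars hpos
  have h3 := T.numBars_mod_two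
  have h4 := oddCount_add_evenCount lam
  -- If the number of rows is odd, `evenCount` and `oddCount` differ in parity, so `evenCount ≤
  -- numBars` is strict.
  omega

end BarTableau

end

/-! ### A bar tableau with the least number of bars -/

noncomputable section

open Finset

section MinimalTableau

variable (lam : List ℕ)

/-- The number of earlier rows whose length has the same parity. -/
def rowRank (i : ℕ) : ℕ :=
  if lam.getD i 0 % 2 = 1 then oddCount (lam.take i) else evenCount (lam.take i)

theorem rowRank_lt_of_odd {i : ℕ} (hi : i < lam.length) (h : lam.getD i 0 % 2 = 1) :
    rowRank lam i < oddCount lam := by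
  have h1 := oddCount_take_succ lam hi
  have h2 : oddCount (lam.take (i + 1)) ≤ oddCount lam :=
    (List.take_sublist _ _).countP_le
  rw [rowRank, if_pos h]
  omega

theorem rowRank_lt_of_even {i : ℕ} (hi : i < lam.length) (h : lam.getD i 0 % 2 = 0) :
    rowRank lam i < evenCount lam := by
  have h1 := evenCount_take_succ lam hi
  have h2 : evenCount (lam.take (i + 1)) ≤ evenCount lam :=
    (List.take_sublist _ _).countP_le
  rw [rowRank, if_neg (by omega)]
  omega

theorem rowRank_lt_rowRank {i j : ℕ} (hij : i < j) (hj : j < lam.length)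
    (h : lam.getD i 0 % 2 = lam.getD j 0 % 2) : rowRank lam i < rowRank lam j := by
  have h1 := oddCount_take_succ lam (hij.trans hj)
  have h2 := evenCount_take_succ lam (hij.trans hj)
  have hs := List.take_sublist_take_left (l := lam) (Nat.succ_le_of_lt hij)
  have h3 : oddCount (lam.take (i + 1)) ≤ oddCount (lam.take j) := hs.countP_le
  have h4 : evenCount (lam.take (i + 1)) ≤ evenCount (lam.take j) := hs.countP_le
  rw [rowRank, rowRank, ← h]
  split_ifs with hodd <;> omega

theorem rowRank_inj {i j : ℕ} (hi : i < lam.length) (hj : j < lam.length)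
    (h : lam.getD i 0 % 2 = lam.getD j 0 % 2) (hr : rowRank lam i = rowRank lam j) : i = j := by
  rcases lt_trichotomy i j with hlt | heq | hlt
  · exact absurd hr (rowRank_lt_rowRank lam hlt hj h).ne
  · exact heq
  · exact absurd hr.symm (rowRank_lt_rowRank lam hlt hi h.symm).ne

/-- `rowRank` is injective on the odd rows with values below their number, hence takes all these
values. -/
theorem exists_oddRow_of_lt {r : ℕ} (hr : r < oddCount lam) :
    ∃ i, i < lam.length ∧ lam.getD i 0 % 2 = 1 ∧ rowRank lam i = r := by
  have hinj : Set.InjOn (rowRank lam) (oddRows lam) := by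
    intro i hi j hj h
    rw [mem_coe, mem_oddRows] at hi hj
    exact rowRank_inj lam hi.1 hj.1 (hi.2.trans hj.2.symm) h
  have himg : (oddRows lam).image (rowRank lam) = range (oddCount lam) := by
    refine eq_of_subset_of_card_le ?_ ?_
    · intro s hs
      obtain ⟨i, hi, rfl⟩ := mem_image.1 hs
      rw [mem_oddRows] at hi
      exact mem_range.2 (rowRank_lt_of_odd lam hi.1 hi.2)
    · rw [card_image_of_injOn hinj, card_range, card_oddRows]
  obtain ⟨i, hi, h⟩ := mem_image.1 (himg ▸ mem_range.2 hr)
  rw [mem_oddRows] at hi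
  exact ⟨i, hi.1, hi.2, h⟩

theorem exists_evenRow_of_lt {r : ℕ} (hr : r < evenCount lam) :
    ∃ i, i < lam.length ∧ lam.getD i 0 % 2 = 0 ∧ rowRank lam i = r := by
  have hinj : Set.InjOn (rowRank lam) (evenRows lam) := by
    intro i hi j hj h
    rw [mem_coe, mem_evenRows] at hi hj
    exact rowRank_inj lam hi.1 hj.1 (hi.2.trans hj.2.symm) h
  have himg : (evenRows lam).image (rowRank lam) = range (evenCount lam) := by
    refine eq_of_subset_of_card_le ?_ ?_
    · intro s hs
      obtain ⟨i, hi, rfl⟩ := mem_image.1 hs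
      rw [mem_evenRows] at hi
      exact mem_range.2 (rowRank_lt_of_even lam hi.1 hi.2)
    · rw [card_image_of_injOn hinj, card_range, card_evenRows]
  obtain ⟨i, hi, h⟩ := mem_image.1 (himg ▸ mem_range.2 hr)
  rw [mem_evenRows] at hi
  exact ⟨i, hi.1, hi.2, h⟩

/-- The number of bars in the even rows that are not matched with an odd row. -/
def surplus : ℕ :=
  if oddCount lam < evenCount lam then evenCount lam - oddCount lam + lam.length % 2 else 0

/-- Each odd row has one bar, shared with the even row of the same rank if there is one. Two paired
surplus rows use two bars; a last unpaired row also needs two, one more than its share. Such a row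
remains exactly if `evenCount - oddCount`, equivalently the number of rows, is odd. -/
theorem surplus_add_oddCount :
    surplus lam + oddCount lam = max (oddCount lam) (evenCount lam + lam.length % 2) := by
  have := oddCount_add_evenCount lam
  rw [surplus]
  split_ifs <;> omega

/-- The even rows that are not matched with an odd row. -/
def IsSurplusRow (i : ℕ) : Prop := lam.getD i 0 % 2 = 0 ∧ oddCount lam ≤ rowRank lam i

instance (i : ℕ) : Decidable (IsSurplusRow lam i) := by
  unfold IsSurplusRow
  infer_instance

/-- The first entry of a row of the minimal bar tableau. The surplus even rows are taken in pairs
`(a, b)`: one bar consists of the row `b` and the first square of the row `a`, another one of the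
rest of the row `a`. The other even rows form bars with odd rows of the same rank. -/
def firstEntry (i : ℕ) : ℕ :=
  if IsSurplusRow lam i then 2 * ((rowRank lam i - oddCount lam) / 2) + 1
  else surplus lam + rowRank lam i + 1

/-- The entries of a row of the minimal bar tableau after the first one. -/
def restEntry (i : ℕ) : ℕ :=
  firstEntry lam i +
    if IsSurplusRow lam i ∧ (rowRank lam i - oddCount lam) % 2 = 0 then 1 else 0

/-- The tableau in arithmetic form, for case analysis: `s` is the position of a row among the
surplus rows, paired as `(0, 1), (2, 3), …`. Surplus rows use the entries up to `surplus`, the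
matched rows those above. -/
theorem entries_of_row {i : ℕ} (hi : i < lam.length) :
    (¬ IsSurplusRow lam i ∧ rowRank lam i < oddCount lam ∧
      firstEntry lam i = surplus lam + rowRank lam i + 1 ∧ restEntry lam i = firstEntry lam i) ∨
    (IsSurplusRow lam i ∧ ∃ s, rowRank lam i = oddCount lam + s ∧ lam.getD i 0 % 2 = 0 ∧
      restEntry lam i ≤ surplus lam ∧ firstEntry lam i = 2 * (s / 2) + 1 ∧
      restEntry lam i = firstEntry lam i + (1 - s % 2)) := by
  by_cases h : IsSurplusRow lam i
  · right
    have h1 := rowRank_lt_of_even lam hi h.1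
    have h2 := oddCount_add_evenCount lam
    have h3 := h.2
    have hf : firstEntry lam i = 2 * ((rowRank lam i - oddCount lam) / 2) + 1 := if_pos h
    have hr : restEntry lam i = firstEntry lam i + (1 - (rowRank lam i - oddCount lam) % 2) := by
      rw [restEntry]
      split_ifs with hc
      · omega
      · have : ¬ (rowRank lam i - oddCount lam) % 2 = 0 := fun h0 => hc ⟨h, h0⟩
        omega
    refine ⟨h, rowRank lam i - oddCount lam, by omega, h.1, ?_, hf, hr⟩
    rw [surplus, if_pos (by omega)]
    omega
  · left
    refine ⟨h, ?_, ?_, ?_⟩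
    · rcases Nat.mod_two_eq_zero_or_one (lam.getD i 0) with h0 | h0
      · by_contra hc
        exact h ⟨h0, by omega⟩
      · exact rowRank_lt_of_odd lam hi h0
    · rw [firstEntry, if_neg h]
    · rw [restEntry, if_neg fun hc => h hc.1, add_zero]

/-- The entries of the minimal bar tableau. -/
def minimalEntry (c : ℕ × ℕ) : ℕ :=
  if c ∈ shiftedDiagram lam then (if c.2 = c.1 then firstEntry lam c.1 else restEntry lam c.1)
  else 0

theorem minimalEntry_of_mem {c : ℕ × ℕ} (hc : c ∈ shiftedDiagram lam) : minimalEntry lam c =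
    if c.2 = c.1 then firstEntry lam c.1 else restEntry lam c.1 := if_pos hc

theorem minimalEntry_eq_or {c : ℕ × ℕ} (hc : c ∈ shiftedDiagram lam) :
    minimalEntry lam c = firstEntry lam c.1 ∨ minimalEntry lam c = restEntry lam c.1 := by
  rw [minimalEntry_of_mem lam hc]
  split_ifs
  · exact Or.inl rfl
  · exact Or.inr rfl

theorem card_row_minimalEntry (hpos : ∀ a ∈ lam, 0 < a) (q : ℕ → Prop) [DecidablePred q] {i : ℕ}
    (hi : i < lam.length) :
    ((shiftedDiagram lam).filter fun c => c.1 = i ∧ q (minimalEntry lam c)).card =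
      (if q (firstEntry lam i) then 1 else 0) +
        if q (restEntry lam i) then lam.getD i 0 - 1 else 0 := by
  have h0 : 0 < lam.getD i 0 := by
    rw [List.getD_eq_getElem _ _ hi]
    exact hpos _ (List.getElem_mem hi)
  rw [card_filter_row lam (fun c => q (minimalEntry lam c)), card_filter]
  have hIco : Ico i (i + lam.getD i 0) = insert i (Ico (i + 1) (i + lam.getD i 0)) := by
    ext j
    simp only [mem_Ico, mem_insert]
    omega
  have hmem : ∀ j ∈ Ico i (i + lam.getD i 0), (i, j) ∈ shiftedDiagram lam := by
    intro j hj
    rw [mem_Ico, List.getD_eq_getElem _ _ hi] at hj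
    exact (mem_shiftedDiagram lam i j).2 ⟨hi, hj⟩
  have h1 : ∀ j ∈ Ico (i + 1) (i + lam.getD i 0),
      (if q (minimalEntry lam (i, j)) then 1 else 0) = if q (restEntry lam i) then 1 else 0 := by
    intro j hj
    rw [minimalEntry_of_mem lam (hmem j (by rw [hIco]; exact mem_insert_of_mem hj)),
      if_neg (show ¬ (i, j).2 = (i, j).1 by rw [mem_Ico] at hj; dsimp only; omega)]
  rw [hIco, sum_insert (by simp), sum_congr rfl h1, sum_const, Nat.card_Ico,
    minimalEntry_of_mem lam (hmem i (by rw [mem_Ico]; omega)), if_pos rfl, smul_eq_mul, mul_ite,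
    mul_one, mul_zero]
  congr 2
  omega

/-- An entry determines its row once a binary tag is known: the parity of the length for matched
rows, the position within the pair for surplus rows. -/
theorem row_eq_of_entries {i j k : ℕ} (hi : i < lam.length) (hj : j < lam.length)
    (hik : k = firstEntry lam i ∨ k = restEntry lam i)
    (hjk : k = firstEntry lam j ∨ k = restEntry lam j)
    (htag : lam.getD i 0 % 2 = lam.getD j 0 % 2)
    (htag' : IsSurplusRow lam i → (rowRank lam i - oddCount lam) % 2 =
      (rowRank lam j - oddCount lam) % 2) : i = j := by
  refine rowRank_inj lam hi hj htag ?_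
  rcases entries_of_row lam hi with ⟨h1, h2, h3, h4⟩ | ⟨h1, s, h2, h3, h4, h5, h6⟩ <;>
    rcases entries_of_row lam hj with ⟨g1, g2, g3, g4⟩ | ⟨g1, u, g2, g3, g4, g5, g6⟩
  · omega
  · omega
  · omega
  · have := htag' h1
    omega

theorem odd_card_minimalEntry (hpos : ∀ a ∈ lam, 0 < a) {c : ℕ × ℕ}
    (hc : c ∈ shiftedDiagram lam) : Odd ((shiftedDiagram lam).filter fun c' =>
      minimalEntry lam c' = minimalEntry lam c).card := by
  set k := minimalEntry lam c with hk
  have hcr := fst_lt_of_mem lam hc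
  rw [card_eq_sum_card_fiberwise (f := Prod.fst) (t := range lam.length)
    (fun c hc => mem_coe.2 (mem_range.2 (fst_lt_of_mem lam (mem_filter.1 hc).1)))]
  have hrow : ∀ i ∈ range lam.length, (((shiftedDiagram lam).filter fun c' =>
      minimalEntry lam c' = k).filter fun c' => c'.1 = i).card =
      (if firstEntry lam i = k then 1 else 0) +
        if restEntry lam i = k then lam.getD i 0 - 1 else 0 := by
    intro i hi
    rw [← card_row_minimalEntry lam hpos (fun v => v = k) (mem_range.1 hi), filter_filter]
    simp only [and_comm]
  have hposr : ∀ i < lam.length, 0 < lam.getD i 0 := fun i hi => by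
    rw [List.getD_eq_getElem _ _ hi]
    exact hpos _ (List.getElem_mem hi)
  rw [sum_congr rfl hrow, odd_sum_iff_odd_card_odd]
  -- the row that contains an odd number of squares of the bar
  have hchar : ∀ i < lam.length, (Odd ((if firstEntry lam i = k then 1 else 0) +
      if restEntry lam i = k then lam.getD i 0 - 1 else 0) ↔
      (k = firstEntry lam i ∨ k = restEntry lam i) ∧
        (lam.getD i 0 % 2 = 1 ∨
          (IsSurplusRow lam i ∧ (rowRank lam i - oddCount lam) % 2 = 0))) := by
    intro i hi
    have h0 := hposr i hi
    rw [Nat.odd_iff]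
    rcases entries_of_row lam hi with ⟨h1, h2, h3, h4⟩ | ⟨h1, s, h2, h3, h4, h5, h6⟩
    · simp only [h1, false_and, or_false, h4, or_self]
      split_ifs <;> constructor <;> intro h <;> first | exact h.elim | omega
    · have hs : (rowRank lam i - oddCount lam) % 2 = s % 2 := by omega
      simp only [h1, true_and, hs]
      rcases Nat.mod_two_eq_zero_or_one s with hs | hs
      · split_ifs <;> constructor <;> intro h <;> first | exact h.elim | omega
      · split_ifs <;> constructor <;> intro h <;> first | exact h.elim | omega
  have hex : ∃ i < lam.length, (k = firstEntry lam i ∨ k = restEntry lam i) ∧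
        (lam.getD i 0 % 2 = 1 ∨
          (IsSurplusRow lam i ∧ (rowRank lam i - oddCount lam) % 2 = 0)) := by
    have hkc : k = firstEntry lam c.1 ∨ k = restEntry lam c.1 := minimalEntry_eq_or lam hc
    rcases entries_of_row lam hcr with ⟨h1, h2, h3, h4⟩ | ⟨h1, s, h2, h3, h4, h5, h6⟩
    · obtain ⟨i, hi, hodd, hrank⟩ := exists_oddRow_of_lt lam h2
      refine ⟨i, hi, ?_, Or.inl hodd⟩
      rcases entries_of_row lam hi with ⟨g1, g2, g3, g4⟩ | ⟨g1, u, g2, g3, g4, g5, g6⟩ <;> omega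
    -- The first row of a pair meets each of its bars in 1 or `λ_i - 1` squares, both odd. The
    -- second row has even length in a single bar, so there the odd part lies in its partner, of
    -- rank one less.
    · rcases Nat.mod_two_eq_zero_or_one s with hs | hs
      · exact ⟨c.1, hcr, hkc, Or.inr ⟨h1, by omega⟩⟩
      · have hlt := rowRank_lt_of_even lam hcr h3
        obtain ⟨i, hi, heven, hrank⟩ := exists_evenRow_of_lt lam (r := rowRank lam c.1 - 1)
          (by omega)
        refine ⟨i, hi, ?_, Or.inr ⟨⟨heven, by omega⟩, by omega⟩⟩
        rcases entries_of_row lam hi with ⟨g1, g2, g3, g4⟩ | ⟨g1, u, g2, g3, g4, g5, g6⟩ <;> omega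
  obtain ⟨i, hi, hki, htag⟩ := hex
  have hsingle : ((range lam.length).filter fun i => Odd ((if firstEntry lam i = k then 1 else 0) +
      if restEntry lam i = k then lam.getD i 0 - 1 else 0)) = {i} := by
    ext j
    rw [mem_filter, mem_range, mem_singleton]
    constructor
    · rintro ⟨hj, hodd⟩
      obtain ⟨hkj, htagj⟩ := (hchar j hj).1 hodd
      rcases entries_of_row lam hi with ⟨h1, h2, h3, h4⟩ | ⟨h1, s, h2, h3, h4, h5, h6⟩ <;>
        rcases entries_of_row lam hj with ⟨g1, g2, g3, g4⟩ | ⟨g1, u, g2, g3, g4, g5, g6⟩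
      · exact row_eq_of_entries lam hj hi hkj hki (by
          simp only [h1, g1, false_and, or_false] at htag htagj
          omega) fun h => absurd h g1
      · omega
      · omega
      · exact row_eq_of_entries lam hj hi hkj hki (by omega) fun _ => by omega
    · rintro rfl
      exact ⟨hi, (hchar j hi).2 ⟨hki, htag⟩⟩
  rw [hsingle, card_singleton]
  exact odd_one

theorem card_rows_minimalEntry (k : ℕ) : (((shiftedDiagram lam).filter fun c =>
    minimalEntry lam c = k).image Prod.fst).card ≤ 2 := by
  let tag : ℕ → ℕ := fun i => if IsSurplusRow lam i then (rowRank lam i - oddCount lam) % 2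
    else lam.getD i 0 % 2
  have hmaps : Set.MapsTo tag (((shiftedDiagram lam).filter fun c =>
      minimalEntry lam c = k).image Prod.fst) (range 2) := by
    intro i _
    simp only [tag, coe_range, Set.mem_Iio]
    split_ifs <;> omega
  refine (card_le_card_of_injOn tag hmaps ?_).trans (card_range 2).le
  intro i hi j hj htag
  have hrow : ∀ i ∈ ((shiftedDiagram lam).filter fun c => minimalEntry lam c = k).image Prod.fst,
      i < lam.length ∧ (k = firstEntry lam i ∨ k = restEntry lam i) := by
    intro i hi
    obtain ⟨c, hc, rfl⟩ := mem_image.1 hi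
    rw [mem_filter] at hc
    have := minimalEntry_eq_or lam hc.1
    rw [hc.2] at this
    exact ⟨fst_lt_of_mem lam hc.1, this⟩
  obtain ⟨hi, hki⟩ := hrow i hi
  obtain ⟨hj, hkj⟩ := hrow j hj
  simp only [tag] at htag
  rcases entries_of_row lam hi with ⟨h1, h2, h3, h4⟩ | ⟨h1, s, h2, h3, h4, h5, h6⟩ <;>
    rcases entries_of_row lam hj with ⟨g1, g2, g3, g4⟩ | ⟨g1, u, g2, g3, g4, g5, g6⟩
  · rw [if_neg h1, if_neg g1] at htag
    exact row_eq_of_entries lam hi hj hki hkj htag fun h => absurd h h1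
  · omega
  · omega
  · rw [if_pos h1, if_pos g1] at htag
    exact row_eq_of_entries lam hi hj hki hkj (by omega) fun _ => htag

/-- Matched rows are constant, and in a pair of surplus rows the shared bar is the one with which
both begin; the bar of the remaining squares lies in one row. -/
theorem firstEntry_eq_of_two_rows {c c' : ℕ × ℕ} (hc : c ∈ shiftedDiagram lam)
    (hc' : c' ∈ shiftedDiagram lam) (h : minimalEntry lam c = minimalEntry lam c')
    (hne : c.1 ≠ c'.1) : firstEntry lam c.1 = minimalEntry lam c := by
  have hi := fst_lt_of_mem lam hc
  have hj := fst_lt_of_mem lam hc'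
  have hki := minimalEntry_eq_or lam hc
  have hkj := minimalEntry_eq_or lam hc'
  rcases entries_of_row lam hi with ⟨h1, h2, h3, h4⟩ | ⟨h1, s, h2, h3, h4, h5, h6⟩ <;>
    rcases entries_of_row lam hj with ⟨g1, g2, g3, g4⟩ | ⟨g1, u, g2, g3, g4, g5, g6⟩
  · omega
  · omega
  · omega
  · by_cases hs : s = u
    · exact absurd (rowRank_inj lam hi hj (by omega) (by omega)) hne
    · omega

/-- The only incomplete nonempty row at any stage is the first row of a surplus pair, reduced to one
square. All other rows then present are complete surplus rows, of even length, because matched rows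
carry larger entries. Complete rows have distinct lengths by strictness. -/
theorem card_row_le_ne (hpos : ∀ a ∈ lam, 0 < a) (hstrict : lam.Pairwise (· > ·)) (k i j : ℕ)
    (hne : i ≠ j)
    (h0 : ((shiftedDiagram lam).filter fun c => c.1 = i ∧ minimalEntry lam c ≤ k).card ≠ 0) :
    ((shiftedDiagram lam).filter fun c => c.1 = i ∧ minimalEntry lam c ≤ k).card ≠
      ((shiftedDiagram lam).filter fun c => c.1 = j ∧ minimalEntry lam c ≤ k).card := by
  intro heq
  have hlt : ∀ i, ((shiftedDiagram lam).filter fun c =>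
      c.1 = i ∧ minimalEntry lam c ≤ k).card ≠ 0 → i < lam.length := by
    intro i h
    obtain ⟨c, hc⟩ := card_ne_zero.1 h
    rw [mem_filter] at hc
    exact hc.2.1 ▸ fst_lt_of_mem lam hc.1
  have hi := hlt i h0
  have hj := hlt j (heq ▸ h0)
  have hdist : lam.getD i 0 ≠ lam.getD j 0 := by
    rw [List.getD_eq_getElem _ _ hi, List.getD_eq_getElem _ _ hj]
    have hn : lam.Nodup := hstrict.imp fun h => ne_of_gt h
    exact fun h => hne ((hn.getElem_inj_iff).1 h)
  have hposr : ∀ i < lam.length, 0 < lam.getD i 0 := fun i hi => by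
    rw [List.getD_eq_getElem _ _ hi]
    exact hpos _ (List.getElem_mem hi)
  have h1 := hposr i hi
  have h2 := hposr j hj
  rw [card_row_minimalEntry lam hpos (fun v => v ≤ k) hi] at heq h0
  rw [card_row_minimalEntry lam hpos (fun v => v ≤ k) hj] at heq
  have hrank := rowRank_inj lam hi hj
  rcases entries_of_row lam hi with ⟨a1, a2, a3, a4⟩ | ⟨a1, s, a2, a3, a4, a5, a6⟩ <;>
    rcases entries_of_row lam hj with ⟨b1, b2, b3, b4⟩ | ⟨b1, u, b2, b3, b4, b5, b6⟩ <;>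
    split_ifs at heq h0 <;> omega

theorem exists_barTableau_numBars_le (hpos : ∀ a ∈ lam, 0 < a) (hstrict : lam.Pairwise (· > ·)) :
    ∃ T : BarTableau lam,
      T.numBars ≤ max (oddCount lam) (evenCount lam + lam.length % 2) := by
  have hbound : ∀ c ∈ shiftedDiagram lam,
      0 < minimalEntry lam c ∧ minimalEntry lam c ≤ surplus lam + oddCount lam := by
    intro c hc
    have h := minimalEntry_eq_or lam hc
    rcases entries_of_row lam (fst_lt_of_mem lam hc) with
      ⟨h1, h2, h3, h4⟩ | ⟨h1, s, h2, h3, h4, h5, h6⟩ <;> omega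
  have hdiag : ∀ c ∈ shiftedDiagram lam, minimalEntry lam (c.1, c.1) = firstEntry lam c.1 := by
    intro c hc
    rw [minimalEntry_of_mem lam (mem_shiftedDiagram_diag lam hpos (fst_lt_of_mem lam hc)),
      if_pos rfl]
  refine ⟨⟨minimalEntry lam, fun c hc => (hbound c hc).1, fun c hc => if_neg hc, ?_,
    fun c hc => odd_card_minimalEntry lam hpos hc, fun k _ => card_rows_minimalEntry lam k, ?_,
    fun k i j hne h0 => card_row_le_ne lam hpos hstrict k i j hne h0⟩, ?_⟩
  · intro i j₁ j₂ hj h1 h2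
    have hle := ((mem_shiftedDiagram lam i j₁).1 h1).2.1
    rw [minimalEntry_of_mem lam h1, minimalEntry_of_mem lam h2]
    have : firstEntry lam i ≤ restEntry lam i := Nat.le_add_right _ _
    dsimp only
    split_ifs <;> omega
  · rintro k _ c hc c' hc' rfl h hne
    rw [hdiag c hc, hdiag c' hc']
    exact ⟨firstEntry_eq_of_two_rows lam hc hc' h.symm hne,
      (firstEntry_eq_of_two_rows lam hc' hc h hne.symm).trans h⟩
  · rw [← surplus_add_oddCount, BarTableau.numBars]
    refine (card_le_card (t := Icc 1 (surplus lam + oddCount lam)) ?_).trans (by simp)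
    intro k hk
    obtain ⟨c, hc, rfl⟩ := mem_image.1 hk
    exact mem_Icc.2 (hbound c hc)

/-- The shifted rank, in terms of the numbers of odd and even parts. -/
theorem srank_eq (hstrict : lam.Pairwise (· > ·)) (hpos : ∀ a ∈ lam, 0 < a) :
    srank lam = max (oddCount lam) (evenCount lam + lam.length % 2) := by
  obtain ⟨T, hT⟩ := exists_barTableau_numBars_le lam hpos hstrict
  rw [srank]
  refine le_antisymm ?_ ?_
  · exact le_trans (Nat.sInf_le (Exists.intro T rfl)) hT
  · refine le_csInf ⟨T.numBars, T, rfl⟩ ?_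
    rintro b ⟨T', rfl⟩
    exact T'.max_le_numBars hpos

end MinimalTableau

end

/-! ### The theorem -/

theorem mainTheorem1 (lam : List ℕ) (hstrict : lam.Pairwise (· > ·))
    (hpos : ∀ a ∈ lam, 0 < a) :
    (∃! F : MvPolynomial ℕ+ ℚ, IsPowerSumExpansion F (schurQ lam)) ∧
    ∀ F : MvPolynomial ℕ+ ℚ, IsPowerSumExpansion F (schurQ lam) →
      IsLeast {d : ℕ | ∃ m ∈ F.support, m.degree = d} (srank lam) := by
  simp only [isPowerSumExpansion_schurQ_iff]
  refine ⟨⟨_, rfl, fun _ h => h⟩, ?_⟩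
  rintro F rfl
  rw [srank_eq lam hstrict hpos]
  exact isLeast_degree_schurQPoly hstrict hpos
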